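/- Let $\mathbf A\in\mathbb R^{s\times s}$, $\mathbf b\in\mathbb R^s$ ($s\ge 1$) be the coefficients of a Runge–Kutta method, put $\mathbf q(z)=\mathbf b^T(I-z\mathbf A)^{-1}$ and $r(z)=1+z\,\mathbf q(z)\mathbb 1$ with $\mathbb 1=(1,\dots,1)^T$, and assume that the method has order at least one ($\sum_i b_i=1$), is $A$-stable ($I-z\mathbf A$ is invertible and $|r(z)|\le 1$ whenever $\operatorname{Re}z\le 0$), that $|r(iy)|<1$ for all real $y\ne0$, that $\mathbf A$ is invertible, and that the method is stiffly accurate ($\mathbf b^T\mathbf A^{-1}=(0,\dots,0,1)$). Fix a norm $\|\cdot\|$ on $\mathbb C^s$. Let $h>0$, $x\in\mathbb R$, $d=|x|$, $t_n=nh$. Let $$K(z,x)=\frac{1}{2\sqrt{z/i}}\exp\bigl(-d\sqrt{z/i}\bigr),\qquad \sqrt{z/i}=e^{-i\pi/4}\sqrt z,$$ with the principal branch of $\sqrt z$ on $\mathbb C\setminus(-\infty,0]$, be the transfer function of the one-dimensional Schrödinger kernel, and let $$G(\lambda,x)=K(\lambda e^{-i\pi},x)-K(\lambda e^{i\pi},x)=\frac{i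 e^{i\pi/4}}{\sqrt\lambda}\cosh\bigl(d e^{i\pi/4}\sqrt\lambda\bigr),\qquad \lambda>0,$$ be its jump across the cut (value from below minus value from above). With $\boldsymbol\Delta(\zeta)=\bigl(\mathbf A+\tfrac{\zeta}{1-\zeta}\mathbb 1\mathbf b^T\bigr)^{-1}$, let $\boldsymbol\omega_n(x)$ be the last row of $\mathbf W_n$ and $\mathbf e_n(z)$ the last row of $\mathbf E_n(z)$, where, for $\zeta$ near $0$, $$\sum_{n\ge0}\mathbf W_n\zeta^n=K\!\left(\frac{\boldsymbol\Delta(\zeta)}{h},x\right),\qquad \sum_{n\ge0}\mathbf E_n(z)\zeta^n=(\boldsymbol\Delta(\zeta)-zI)^{-1}$$ (matrix function in the usual sense). For $\xi>0$ put $$\mathbf I_n=\frac{h}{2\pi i}\int_0^\xi G(\lambda,x)\,\mathbf e_n(-h\lambda)\,d\lambda .$$ Then, for all $h>0$, $\xi>0$, $x\in\mathbb R$ and $n\ge0$, the integral defining $\mathbf I_n$ and the two integrals below converge, and $$\|\boldsymbol\omega_n(x)-\mathbf I_n\|\le \frac{h}{4\pi}\int_0^\infty\|\mathbf e_n(h(-\xi+iy))\|\,e^{-d\operatorname{Re}(e^{-i\pi/4}\sqrt{-\xi+iy})}(\xi^2+y^2)^{-1/4}dy+\frac{h}{4\pi}\int_0^\infty\|\mathbf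 e_n(h(-\xi-iy))\|\,e^{-d\operatorname{Re}(e^{-i\pi/4}\sqrt{-\xi-iy})}(\xi^2+y^2)^{-1/4}dy .$$ Moreover there is a constant $C_A>0$, depending only on the method and the norm, with $$\max\bigl(|r(z)|,\|\mathbf q(z)\|\bigr)\le C_A|z|^{-1}\qquad\text{for all } z\neq0 \text{ with }\operatorname{Re}z\le0,$$ and for every such constant, and all $h,\xi,x,n$ as above, $$\|\boldsymbol\omega_n(x)-\mathbf I_n\|\le C_A\,\frac{\sqrt{2\pi/\xi}}{2\,\Gamma(3/4)^2}\,\cosh\bigl(d\sqrt{\xi/2}\bigr)\,e^{-\gamma(h\xi)\,t_n\,\xi},$$ where $\gamma(\eta)=\inf\{\log|r(z)|/\operatorname{Re}z:\ -\eta\le\operatorname{Re}z<0,\ r(z)\ne0\}$ for $\eta>0$. -/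

import Mathlib

open Complex MeasureTheory Set

noncomputable section

/-- The coefficients `A`, `b` of an `s`-stage Runge-Kutta method, `s = m + 1`.  (The nodes `c` of
the Butcher tableau only say where the data are sampled; they do not enter the weights.) -/
structure RungeKutta (m : ℕ) where
  A : Matrix (Fin (m + 1)) (Fin (m + 1)) ℝ
  b : Fin (m + 1) → ℝ

namespace RungeKutta

variable {m : ℕ} (M : RungeKutta m)

/-- The coefficient matrix with complex entries. -/
def Ac : Matrix (Fin (m + 1)) (Fin (m + 1)) ℂ := M.A.map (fun t : ℝ => (t : ℂ))

/-- The vector `b` with complex entries. -/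
def bc : Fin (m + 1) → ℂ := fun i => (M.b i : ℂ)

/-- The row vector `q(z) = bᵀ (I - z A)⁻¹`. -/
def q (z : ℂ) : Fin (m + 1) → ℂ := Matrix.vecMul M.bc (1 - z • M.Ac)⁻¹

/-- The stability function `r(z) = 1 + z bᵀ (I - z A)⁻¹ 𝟙`. -/
def r (z : ℂ) : ℂ := 1 + z * (M.q z ⬝ᵥ (fun _ => 1))

/-- The standing assumptions on the method. -/
structure Admissible : Prop where
  /-- Order at least one. -/
  order_one : ∑ i, M.b i = 1
  /-- A-stability, first part: the stage equations are solvable for every `z` in the closed left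
  half-plane, so that `r(z)` and `q(z)` are defined there. -/
  nonsingular : ∀ z : ℂ, z.re ≤ 0 → IsUnit (1 - z • M.Ac)
  /-- A-stability, second part. -/
  norm_r_le : ∀ z : ℂ, z.re ≤ 0 → ‖M.r z‖ ≤ 1
  norm_r_lt : ∀ y : ℝ, y ≠ 0 → ‖M.r (y * I)‖ < 1
  invertible : IsUnit M.A
  /-- Stiff accuracy, `bᵀ A⁻¹ = (0, …, 0, 1)`. -/
  stiffly_accurate : Matrix.vecMul M.b M.A⁻¹ = Pi.single (Fin.last m) 1

/-- The symbol `Δ(ζ) = (A + ζ / (1 - ζ) 𝟙 bᵀ)⁻¹`. -/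
def symbol (ζ : ℂ) : Matrix (Fin (m + 1)) (Fin (m + 1)) ℂ :=
  (M.Ac + (ζ / (1 - ζ)) • Matrix.vecMulVec (fun _ => 1) M.bc)⁻¹

/-- `γ(ξ) = inf { log |r(z)| / Re z : -ξ ≤ Re z ≤ 0 }`.  Points with `Re z = 0`, where the quotient
is not a finite number, and zeros of `r`, where it is `+∞`, do not contribute to the infimum. -/
def gammaInf (ξ : ℝ) : ℝ :=
  sInf {t : ℝ | ∃ z : ℂ, -ξ ≤ z.re ∧ z.re < 0 ∧ M.r z ≠ 0 ∧ t = Real.log ‖M.r z‖ / z.re}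

/-- `C > 0` satisfies `max (|r(z)|, ‖q(z)‖) ≤ C |z|⁻¹` for all `Re z ≤ 0`
(written without division; at `z = 0` there is nothing to check). -/
def IsDecayConstant (N : Seminorm ℂ (Fin (m + 1) → ℂ)) (C : ℝ) : Prop :=
  0 < C ∧ ∀ z : ℂ, z.re ≤ 0 → ‖z‖ * max ‖M.r z‖ (N (M.q z)) ≤ C

end RungeKutta

/-- The `n`-th coefficient of the power series expansion about `0` of a matrix-valued function. -/
def powerCoeff {m : ℕ} (F : ℂ → Matrix (Fin (m + 1)) (Fin (m + 1)) ℂ) (n : ℕ) :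
    Matrix (Fin (m + 1)) (Fin (m + 1)) ℂ :=
  fun i j => iteratedDeriv n (fun ζ => F ζ i j) 0 / (n.factorial : ℂ)

/-- `p` interpolates `f` on the spectrum of `B`: at each eigenvalue `μ`, where `f` has to be
analytic, `p` and `f` have the same derivatives of all orders below the algebraic multiplicity. -/
def InterpolatesOnSpectrum {m : ℕ} (f : ℂ → ℂ) (B : Matrix (Fin (m + 1)) (Fin (m + 1)) ℂ)
    (p : Polynomial ℂ) : Prop :=
  ∀ μ : ℂ, B.charpoly.IsRoot μ → AnalyticAt ℂ f μ ∧
    ∀ j < B.charpoly.rootMultiplicity μ,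
      (Polynomial.derivative^[j] p).eval μ = iteratedDeriv j f μ

open scoped Classical in
/-- The matrix function `f(B) = p(B)`, where `p` is any polynomial that interpolates `f` on the
spectrum of `B` (by the Cayley-Hamilton theorem the choice of `p` does not matter). -/
def matrixFunction {m : ℕ} (f : ℂ → ℂ) (B : Matrix (Fin (m + 1)) (Fin (m + 1)) ℂ) :
    Matrix (Fin (m + 1)) (Fin (m + 1)) ℂ :=
  if H : ∃ p : Polynomial ℂ, InterpolatesOnSpectrum f B p then Polynomial.aeval B H.choose else 0

/-- `exp (-d u) / (2 u)` with `u = e^{-iπ/4} w`: the one-dimensional transfer function in terms of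
the value `w` of `√z`. -/
def transferOfSqrt (d : ℝ) (w : ℂ) : ℂ :=
  Complex.exp (-(d * (Complex.exp (-(Real.pi * I) / 4) * w))) /
    (2 * (Complex.exp (-(Real.pi * I) / 4) * w))

/-- The transfer function `K(z, x) = exp (-|x| √(z/i)) / (2 √(z/i))`, where
`√(z/i) = e^{-iπ/4} √z` with the principal branch of `√z`, cut along `(-∞, 0]`. -/
def transferFn (x : ℝ) (z : ℂ) : ℂ := transferOfSqrt |x| (z ^ (1 / 2 : ℂ))

/-- `G(λ, x) = K(λ e^{-iπ}, x) - K(λ e^{iπ}, x)`, the jump of `K` across the cut at `-λ`: the values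
of `√z` on the lower and on the upper side are `√λ e^{-iπ/2}` and `√λ e^{iπ/2}`. -/
def jumpFn (x : ℝ) (l : ℝ) : ℂ :=
  transferOfSqrt |x| (Real.sqrt l * Complex.exp (-(Real.pi * I) / 2)) -
    transferOfSqrt |x| (Real.sqrt l * Complex.exp (Real.pi * I / 2))

namespace RungeKutta

variable {m : ℕ} (M : RungeKutta m)

/-- `e_n(z)`, the last row of `E_n(z)`, where `∑ E_n(z) ζⁿ = (Δ(ζ) - z I)⁻¹`. -/
def eVec (n : ℕ) (z : ℂ) : Fin (m + 1) → ℂ :=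
  powerCoeff (fun ζ => (M.symbol ζ - z • (1 : Matrix (Fin (m + 1)) (Fin (m + 1)) ℂ))⁻¹) n
    (Fin.last m)

/-- `ω_n(x)`, the last row of the convolution quadrature weight `W_n`, where
`∑ W_n ζⁿ = K(Δ(ζ) / h, x)`. -/
def weight (h x : ℝ) (n : ℕ) : Fin (m + 1) → ℂ :=
  powerCoeff (fun ζ => matrixFunction (transferFn x) ((h : ℂ)⁻¹ • M.symbol ζ)) n (Fin.last m)

/-- `I_n = h / (2πi) ∫₀^ξ G(λ, x) e_n(-hλ) dλ`. -/
def truncated (h ξ x : ℝ) (n : ℕ) : Fin (m + 1) → ℂ :=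
  ((h : ℂ) / (2 * Real.pi * I)) •
    ∫ l in (0 : ℝ)..ξ, jumpFn x l • M.eVec n (-((h : ℂ) * (l : ℂ)))

/-- `‖e_n(h z)‖ e^{-d Re (e^{-iπ/4} √z)} (ξ² + y²)^{-1/4}` at `z = -ξ + i σ y`, with `d = |x|`;
`σ = 1` and `σ = -1` give the integrands on the upper and the lower vertical half-line. -/
def lineIntegrand (N : Seminorm ℂ (Fin (m + 1) → ℂ)) (h ξ x : ℝ) (n : ℕ) (σ y : ℝ) : ℝ :=
  N (M.eVec n ((h : ℂ) * (-(ξ : ℂ) + I * σ * y))) *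
    Real.exp (-|x| * (Complex.exp (-(Real.pi * I) / 4) *
      (-(ξ : ℂ) + I * σ * y) ^ (1 / 2 : ℂ)).re) *
    (ξ ^ 2 + y ^ 2) ^ (-(1 / 4) : ℝ)

end RungeKutta

end

/-!
`K` decays like `|z|^(-1/2)` and is analytic off the cut `(-∞, 0]`, so for `Re z > 0` Cauchy's
formula can be pushed onto the vertical line `Re w = -ξ` together with the piece `[-ξ, 0]` of the
cut, where the two sides of the cut combine to the jump `G`:
`K(z) = ∫₀^ξ (-G(λ)) / (2πi) / (-λ - z) dλ - (1 / 2π) ∫ K(-ξ + iy) / (-ξ + iy - z) dy`.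
For `|ζ| < 1` the eigenvalues of `Δ(ζ) / h` lie in the right half-plane, so the matrix function may
be taken under the integral signs. Each resolvent `(w - Δ(ζ) / h)⁻¹` then contributes its power
series in `ζ`, whose last rows are `-h eₙ(h w)`. Hence the cut contributes exactly `Iₙ`, and the
error is the integral over the line. Stiff accuracy gives `eₙ(z) = r(z)ⁿ q(z)`; on the line `r` is
bounded by `γ` and `q` by `C / |z|`, which leaves the convergent integral of `(ξ² + y²)^(-3/4)`.
-/

section

open Filter Topology Polynomial

section CauchyTransform

/-- A density `φ` along a curve `w` in the closed left half-plane whose Cauchy transform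
`z ↦ ∫ φ / (w - z)` converges absolutely on the open right half-plane. -/
structure CauchyDatum {α : Type*} [MeasurableSpace α] (μ : Measure α) (w φ : α → ℂ) : Prop where
  measurable_curve : AEStronglyMeasurable w μ
  measurable_density : AEStronglyMeasurable φ μ
  re_nonpos : ∀ᵐ a ∂μ, (w a).re ≤ 0
  integrable : Integrable (fun a => ‖φ a‖ / (1 + ‖w a‖)) μ

theorem one_add_norm_le_mul_norm_sub {E : Type*} [SeminormedAddCommGroup E] {w z : E} {δ : ℝ}
    (hδ : 0 < δ) (h : δ ≤ ‖w - z‖) : 1 + ‖w‖ ≤ ((1 + ‖z‖) / δ + 1) * ‖w - z‖ := by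
  have h1 : ‖w‖ ≤ ‖w - z‖ + ‖z‖ := by simpa using norm_add_le (w - z) z
  have h2 : 1 + ‖z‖ ≤ (1 + ‖z‖) / δ * ‖w - z‖ := by
    rw [div_mul_eq_mul_div, le_div_iff₀ hδ]
    gcongr
  linarith

theorem re_le_norm_sub_of_re_nonpos {w z : ℂ} (hw : w.re ≤ 0) : z.re ≤ ‖w - z‖ := by
  have := neg_le_of_abs_le (abs_re_le_norm (w - z))
  rw [sub_re] at this
  linarith

theorem norm_inv_sub_le {w z : ℂ} {δ : ℝ} (hδ : 0 < δ) (hw : w.re ≤ 0) (hz : δ ≤ z.re) :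
    ‖(w - z)⁻¹‖ ≤ ((1 + ‖z‖) / δ + 1) / (1 + ‖w‖) := by
  have h := hz.trans (re_le_norm_sub_of_re_nonpos hw)
  rw [norm_inv, inv_eq_one_div, div_le_div_iff₀ (hδ.trans_le h) (by positivity), one_mul]
  exact one_add_norm_le_mul_norm_sub hδ h

theorem norm_inv_sub_sq_le {w z : ℂ} {δ : ℝ} (hδ : 0 < δ) (hw : w.re ≤ 0) (hz : δ ≤ z.re) :
    ‖((w - z) ^ 2)⁻¹‖ ≤ ((1 + ‖z‖) / δ + 1) / δ / (1 + ‖w‖) := by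
  have h1 : ‖(w - z)⁻¹‖ ≤ δ⁻¹ := by
    rw [norm_inv]
    exact inv_anti₀ hδ (hz.trans (re_le_norm_sub_of_re_nonpos hw))
  calc ‖((w - z) ^ 2)⁻¹‖ = ‖(w - z)⁻¹‖ * ‖(w - z)⁻¹‖ := by rw [← inv_pow, norm_pow, sq]
    _ ≤ ((1 + ‖z‖) / δ + 1) / (1 + ‖w‖) * δ⁻¹ := by gcongr; exact norm_inv_sub_le hδ hw hz
    _ = _ := by ring

theorem half_re_le_re_of_mem_ball {z z₀ : ℂ} (hz : z ∈ Metric.ball z₀ (z₀.re / 2)) :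
    z₀.re / 2 ≤ z.re := by
  have h := neg_le_of_abs_le ((abs_re_le_norm (z - z₀)).trans (mem_ball_iff_norm.1 hz).le)
  rw [sub_re] at h
  linarith

namespace CauchyDatum

variable {α : Type*} [MeasurableSpace α] {μ : Measure α} {w φ : α → ℂ}

theorem aestronglyMeasurable_comp (H : CauchyDatum μ w φ) {g : ℂ → ℂ} (hg : Measurable g) :
    AEStronglyMeasurable (fun a => g (w a)) μ :=
  (hg.comp_aemeasurable H.measurable_curve.aemeasurable).aestronglyMeasurable

theorem integrable_smul {E : Type*} [NormedAddCommGroup E] [NormedSpace ℂ E]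
    (H : CauchyDatum μ w φ) {g : α → E} (hg : AEStronglyMeasurable g μ) {C : ℝ}
    (h : ∀ a, (w a).re ≤ 0 → ‖g a‖ ≤ C / (1 + ‖w a‖)) : Integrable (fun a => φ a • g a) μ := by
  refine (H.integrable.const_mul C).mono' (H.measurable_density.smul hg) ?_
  filter_upwards [H.re_nonpos] with a ha
  calc ‖φ a • g a‖ = ‖φ a‖ * ‖g a‖ := norm_smul _ _
    _ ≤ ‖φ a‖ * (C / (1 + ‖w a‖)) := by gcongr; exact h a ha
    _ = _ := by ring

theorem mul_comp (H : CauchyDatum μ w φ) {g : ℂ → ℂ} (hg : Measurable g) {C : ℝ}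
    (h : ∀ z : ℂ, z.re ≤ 0 → ‖g z‖ ≤ C) : CauchyDatum μ w (fun a => φ a * g (w a)) where
  measurable_curve := H.measurable_curve
  measurable_density := H.measurable_density.mul (H.aestronglyMeasurable_comp hg)
  re_nonpos := H.re_nonpos
  integrable := by
    have hm : AEStronglyMeasurable (fun a => ‖φ a * g (w a)‖ / (1 + ‖w a‖)) μ :=
      ((H.measurable_density.mul (H.aestronglyMeasurable_comp hg)).norm.aemeasurable.div
        (H.measurable_curve.norm.aemeasurable.const_add 1)).aestronglyMeasurable
    refine (H.integrable.const_mul C).mono' hm ?_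
    filter_upwards [H.re_nonpos] with a ha
    rw [Real.norm_of_nonneg (by positivity), norm_mul]
    calc ‖φ a‖ * ‖g (w a)‖ / (1 + ‖w a‖) ≤ ‖φ a‖ * C / (1 + ‖w a‖) := by gcongr; exact h _ ha
      _ = _ := by ring

theorem integrable_div (H : CauchyDatum μ w φ) {z : ℂ} (hz : 0 < z.re) :
    Integrable (fun a => φ a / (w a - z)) μ := by
  simp_rw [div_eq_mul_inv]
  exact H.integrable_smul (H.aestronglyMeasurable_comp (g := fun x => (x - z)⁻¹) (by fun_prop))
    fun a ha => norm_inv_sub_le hz ha le_rfl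

theorem differentiableAt (H : CauchyDatum μ w φ) {z₀ : ℂ} (hz₀ : 0 < z₀.re) :
    DifferentiableAt ℂ (fun z => ∫ a, φ a / (w a - z) ∂μ) z₀ := by
  set δ := z₀.re / 2
  have hδ0 : 0 < δ := by positivity
  have norm_le : ∀ z ∈ Metric.ball z₀ δ, ‖z‖ ≤ ‖z₀‖ + δ := fun z hz => by
    simpa using (norm_add_le z₀ (z - z₀)).trans (by gcongr; exact (mem_ball_iff_norm.1 hz).le)
  refine (hasDerivAt_integral_of_dominated_loc_of_deriv_le (F := fun z a => φ a / (w a - z))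
    (F' := fun z a => φ a / (w a - z) ^ 2)
    (bound := fun a => ((1 + (‖z₀‖ + δ)) / δ + 1) / δ * (‖φ a‖ / (1 + ‖w a‖)))
    (Metric.ball_mem_nhds z₀ hδ0) ?_ (H.integrable_div hz₀) ?_ ?_
    (H.integrable.const_mul _) ?_).2.differentiableAt
  · filter_upwards [Metric.ball_mem_nhds z₀ hδ0] with z hz
    exact (H.integrable_div (hδ0.trans_le (half_re_le_re_of_mem_ball hz))).aestronglyMeasurable
  · simp_rw [div_eq_mul_inv]
    exact H.measurable_density.mul
      (H.aestronglyMeasurable_comp (g := fun x => ((x - z₀) ^ 2)⁻¹) (by fun_prop))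
  · filter_upwards [H.re_nonpos] with a ha z hz
    calc ‖φ a / (w a - z) ^ 2‖ = ‖φ a‖ * ‖((w a - z) ^ 2)⁻¹‖ := by rw [div_eq_mul_inv, norm_mul]
      _ ≤ ‖φ a‖ * (((1 + ‖z‖) / δ + 1) / δ / (1 + ‖w a‖)) := by
        gcongr; exact norm_inv_sub_sq_le hδ0 ha (half_re_le_re_of_mem_ball hz)
      _ ≤ ‖φ a‖ * (((1 + (‖z₀‖ + δ)) / δ + 1) / δ / (1 + ‖w a‖)) := by gcongr; exact norm_le z hz
      _ = _ := by ring
  · filter_upwards [H.re_nonpos] with a ha z hz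
    have hne : w a - z ≠ 0 := norm_pos_iff.1 <| hδ0.trans_le <|
      (half_re_le_re_of_mem_ball hz).trans (re_le_norm_sub_of_re_nonpos ha)
    simpa [div_eq_mul_inv] using
      ((hasDerivAt_id z).const_sub (w a)).inv hne |>.const_mul (φ a)

theorem analyticAt (H : CauchyDatum μ w φ) {z : ℂ} (hz : 0 < z.re) :
    AnalyticAt ℂ (fun z => ∫ a, φ a / (w a - z) ∂μ) z :=
  (show DifferentiableOn ℂ _ {z : ℂ | 0 < z.re} from fun _ hz =>
    (H.differentiableAt hz).differentiableWithinAt).analyticAt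
    ((isOpen_lt continuous_const continuous_re).mem_nhds hz)

end CauchyDatum

end CauchyTransform

section Interpolation

theorem exists_mul_pow_le_norm_prod (S : Multiset ℂ) (hS : ∀ μ ∈ S, 0 < μ.re) :
    ∃ c : ℝ, 0 < c ∧ ∀ w : ℂ, w.re ≤ 0 →
      c * (1 + ‖w‖) ^ S.card ≤ ‖(S.map (fun μ => w - μ)).prod‖ := by
  induction S using Multiset.induction_on with
  | empty => exact ⟨1, one_pos, by simp⟩
  | cons μ S ih =>
    obtain ⟨c, hc, h⟩ := ih fun ν hν => hS ν (Multiset.mem_cons_of_mem hν)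
    have hμ := hS μ (Multiset.mem_cons_self μ S)
    have hk : 0 < (1 + ‖μ‖) / μ.re + 1 := by positivity
    refine ⟨c / ((1 + ‖μ‖) / μ.re + 1), by positivity, fun w hw => ?_⟩
    have h1 := one_add_norm_le_mul_norm_sub hμ (re_le_norm_sub_of_re_nonpos (z := μ) hw)
    rw [Multiset.map_cons, Multiset.prod_cons, norm_mul, Multiset.card_cons, pow_succ]
    calc _ = ((1 + ‖w‖) / ((1 + ‖μ‖) / μ.re + 1)) * (c * (1 + ‖w‖) ^ S.card) := by ring
      _ ≤ _ := by
        gcongr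
        · rwa [div_le_iff₀' hk]
        · exact h w hw

theorem exists_mul_pow_le_norm_eval {p : ℂ[X]} (hp : p.Monic) (hre : ∀ μ, p.IsRoot μ → 0 < μ.re) :
    ∃ c : ℝ, 0 < c ∧ ∀ w : ℂ, w.re ≤ 0 → c * (1 + ‖w‖) ^ p.natDegree ≤ ‖p.eval w‖ := by
  have hs := IsAlgClosed.splits p
  obtain ⟨c, hc, h⟩ :=
    exists_mul_pow_le_norm_prod p.roots fun μ hμ => hre μ (isRoot_of_mem_roots hμ)
  refine ⟨c, hc, fun w hw => ?_⟩
  rw [hs.eval_eq_prod_roots_of_monic hp, hs.natDegree_eq_card_roots]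
  exact h w hw

theorem eval_ne_zero_of_re_nonpos {p : ℂ[X]} (hre : ∀ μ, p.IsRoot μ → 0 < μ.re) {w : ℂ}
    (hw : w.re ≤ 0) : p.eval w ≠ 0 := fun h => absurd (hre w h) (not_lt.2 hw)

theorem exists_norm_inv_eval_le {p : ℂ[X]} (hp : p.Monic) (hre : ∀ μ, p.IsRoot μ → 0 < μ.re) :
    ∃ C : ℝ, ∀ w : ℂ, w.re ≤ 0 → ‖(p.eval w)⁻¹‖ ≤ C := by
  obtain ⟨c, hc, h⟩ := exists_mul_pow_le_norm_eval hp hre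
  refine ⟨c⁻¹, fun w hw => ?_⟩
  rw [norm_inv]
  refine inv_anti₀ hc (le_trans ?_ (h w hw))
  exact le_mul_of_one_le_right hc.le (one_le_pow₀ (by linarith [norm_nonneg w]))

theorem X_sub_C_mul_divByMonic {R : Type*} [CommRing R] (p : R[X]) (w : R) :
    (X - C w) * (p /ₘ (X - C w)) = p - C (p.eval w) := by
  rw [eq_sub_iff_add_eq', ← modByMonic_X_sub_C_eq_C_eval, modByMonic_add_div]

theorem norm_coeff_divByMonic_X_sub_C_le (p : ℂ[X]) (w : ℂ) (k : ℕ) :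
    (1 + ‖w‖) * ‖(p /ₘ (X - C w)).coeff k‖ ≤
      (∑ i ∈ Finset.range (p.natDegree + 1), ‖p.coeff i‖) * (1 + ‖w‖) ^ p.natDegree := by
  have hw : 1 ≤ 1 + ‖w‖ := by linarith [norm_nonneg w]
  have hpow : ∀ i ∈ Finset.Icc (k + 1) p.natDegree,
      (1 + ‖w‖) * ‖w ^ (i - (k + 1)) * p.coeff i‖ ≤ ‖p.coeff i‖ * (1 + ‖w‖) ^ p.natDegree := by
    intro i hi
    rw [Finset.mem_Icc] at hi
    calc (1 + ‖w‖) * ‖w ^ (i - (k + 1)) * p.coeff i‖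
        = ‖p.coeff i‖ * (‖w‖ ^ (i - (k + 1)) * (1 + ‖w‖)) := by rw [norm_mul, norm_pow]; ring
      _ ≤ ‖p.coeff i‖ * ((1 + ‖w‖) ^ (i - (k + 1)) * (1 + ‖w‖)) := by gcongr; linarith
      _ ≤ ‖p.coeff i‖ * (1 + ‖w‖) ^ p.natDegree := by
        rw [← pow_succ]
        exact mul_le_mul_of_nonneg_left (pow_le_pow_right₀ hw (by omega)) (norm_nonneg _)
  rw [coeff_divByMonic_X_sub_C]
  calc (1 + ‖w‖) * ‖∑ i ∈ Finset.Icc (k + 1) p.natDegree, w ^ (i - (k + 1)) * p.coeff i‖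
      ≤ ∑ i ∈ Finset.Icc (k + 1) p.natDegree, (1 + ‖w‖) * ‖w ^ (i - (k + 1)) * p.coeff i‖ := by
        rw [← Finset.mul_sum]; gcongr; exact norm_sum_le _ _
    _ ≤ ∑ i ∈ Finset.Icc (k + 1) p.natDegree, ‖p.coeff i‖ * (1 + ‖w‖) ^ p.natDegree :=
        Finset.sum_le_sum hpow
    _ ≤ _ := by
        rw [← Finset.sum_mul]
        gcongr
        intro i hi
        simp only [Finset.mem_Icc, Finset.mem_range] at hi ⊢
        omega

/-- The remainder modulo `p` of the Cauchy kernel `z ↦ (w - z)⁻¹`.  For `p` the characteristic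
polynomial of a matrix `B`, its value at `B` is the resolvent `(w - B)⁻¹`. -/
noncomputable def cauchyInterpolant (p : ℂ[X]) (w : ℂ) : ℂ[X] :=
  C (p.eval w)⁻¹ * (p /ₘ (X - C w))

theorem coeff_cauchyInterpolant (p : ℂ[X]) (w : ℂ) (k : ℕ) :
    (cauchyInterpolant p w).coeff k =
      (p.eval w)⁻¹ * ∑ i ∈ Finset.Icc (k + 1) p.natDegree, w ^ (i - (k + 1)) * p.coeff i := by
  rw [cauchyInterpolant, coeff_C_mul, coeff_divByMonic_X_sub_C]

theorem degree_cauchyInterpolant_lt {p : ℂ[X]} (hp : p ≠ 0) (w : ℂ) :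
    (cauchyInterpolant p w).degree < p.natDegree := by
  rw [← degree_eq_natDegree hp]
  rw [cauchyInterpolant, C_mul']
  exact (degree_smul_le _ _).trans_lt (degree_divByMonic_lt _ _ hp (by simp))

theorem inv_sub_eq_eval_cauchyInterpolant {p : ℂ[X]} {w z : ℂ} (hw : p.eval w ≠ 0) (hz : w ≠ z) :
    (w - z)⁻¹ = (cauchyInterpolant p w).eval z + p.eval z * ((p.eval w)⁻¹ * (w - z)⁻¹) := by
  have h := congrArg (eval z) (X_sub_C_mul_divByMonic p w)
  simp only [eval_mul, eval_sub, eval_X, eval_C] at h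
  rw [cauchyInterpolant, eval_C_mul]
  have := sub_ne_zero.2 hz
  field_simp
  linear_combination h

theorem exists_norm_coeff_cauchyInterpolant_le {p : ℂ[X]} (hp : p.Monic)
    (hre : ∀ μ, p.IsRoot μ → 0 < μ.re) :
    ∃ D : ℝ, ∀ w : ℂ, w.re ≤ 0 → ∀ k, ‖(cauchyInterpolant p w).coeff k‖ ≤ D / (1 + ‖w‖) := by
  obtain ⟨c, hc, h⟩ := exists_mul_pow_le_norm_eval hp hre
  set S := ∑ i ∈ Finset.range (p.natDegree + 1), ‖p.coeff i‖
  refine ⟨S / c, fun w hw k => ?_⟩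
  have hpos : 0 < c * (1 + ‖w‖) ^ p.natDegree := by positivity
  rw [cauchyInterpolant, coeff_C_mul, norm_mul, norm_inv, le_div_iff₀ (by positivity)]
  calc ‖p.eval w‖⁻¹ * ‖(p /ₘ (X - C w)).coeff k‖ * (1 + ‖w‖)
      = ‖p.eval w‖⁻¹ * ((1 + ‖w‖) * ‖(p /ₘ (X - C w)).coeff k‖) := by ring
    _ ≤ (c * (1 + ‖w‖) ^ p.natDegree)⁻¹ * (S * (1 + ‖w‖) ^ p.natDegree) := by
        exact mul_le_mul (inv_anti₀ hpos (h w hw)) (norm_coeff_divByMonic_X_sub_C_le p w k)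
          (by positivity) (by positivity)
    _ = S / c := by field_simp

variable {ι : Type*} [Fintype ι] [DecidableEq ι]

theorem aeval_cauchyInterpolant (B : Matrix ι ι ℂ) {w : ℂ} (hw : B.charpoly.eval w ≠ 0) :
    aeval B (cauchyInterpolant B.charpoly w) = (w • 1 - B)⁻¹ := by
  symm
  apply Matrix.inv_eq_right_inv
  have h := congrArg (aeval B) (X_sub_C_mul_divByMonic B.charpoly w)
  rw [map_mul, map_sub, map_sub, aeval_X, aeval_C, aeval_C, Matrix.aeval_self_charpoly, zero_sub,
    Algebra.algebraMap_eq_smul_one, Algebra.algebraMap_eq_smul_one] at h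
  rw [cauchyInterpolant, C_mul', map_smul, Matrix.mul_smul, ← neg_sub B, neg_mul, h, neg_neg,
    smul_smul, inv_mul_cancel₀ hw, one_smul]

theorem map_eq_sum_coeff_smul {R E : Type*} [Semiring R] [AddCommMonoid E] [Module R E] {p : R[X]}
    {n : ℕ} (hp : p.degree < n) (L : R[X] →ₗ[R] E) :
    L p = ∑ k ∈ Finset.range n, p.coeff k • L (X ^ k) := by
  have hsum : p = ∑ k ∈ Finset.range n, p.coeff k • X ^ k := by
    ext i
    simp only [finsetSum_coeff, coeff_smul, coeff_X_pow, smul_eq_mul, mul_ite, mul_one, mul_zero,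
      Finset.sum_ite_eq, Finset.mem_range]
    split_ifs with hi
    · rfl
    · exact (degree_lt_iff_coeff_zero p n).1 hp i (not_lt.1 hi)
  conv_lhs => rw [hsum]
  simp only [map_sum, map_smul]

/-- The linear map `p ↦ p(B)ᵢ`, the `i`-th row of `p(B)`. -/
noncomputable def aevalRow (B : Matrix ι ι ℂ) (i : ι) : ℂ[X] →ₗ[ℂ] ι → ℂ :=
  LinearMap.proj i ∘ₗ (aeval B).toLinearMap

theorem aevalRow_apply (B : Matrix ι ι ℂ) (i : ι) (p : ℂ[X]) : aevalRow B i p = aeval B p i := rfl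

theorem exists_norm_resolvent_le {B : Matrix ι ι ℂ} (hB : ∀ μ, B.charpoly.IsRoot μ → 0 < μ.re)
    (i : ι) : ∃ D : ℝ, ∀ w : ℂ, w.re ≤ 0 → ‖(w • 1 - B)⁻¹ i‖ ≤ D / (1 + ‖w‖) := by
  obtain ⟨D, hD⟩ := exists_norm_coeff_cauchyInterpolant_le B.charpoly_monic hB
  set n := B.charpoly.natDegree
  refine ⟨∑ k ∈ Finset.range n, D * ‖aevalRow B i (X ^ k)‖, fun w hw => ?_⟩
  rw [← aeval_cauchyInterpolant B (eval_ne_zero_of_re_nonpos hB hw), ← aevalRow_apply,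
    map_eq_sum_coeff_smul (degree_cauchyInterpolant_lt B.charpoly_monic.ne_zero w), Finset.sum_div]
  refine norm_sum_le_of_le _ fun k _ => ?_
  rw [norm_smul, mul_div_right_comm]
  gcongr
  exact hD w hw k

theorem exists_forall_map_eq_integral {α : Type*} [MeasurableSpace α] {μ : Measure α}
    {p : α → ℂ[X]} {n : ℕ} (hdeg : ∀ a, (p a).degree < n)
    (hint : ∀ k, Integrable (fun a => (p a).coeff k) μ) :
    ∃ P : ℂ[X], ∀ {E : Type*} [NormedAddCommGroup E] [NormedSpace ℂ E] [CompleteSpace E]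
      (L : ℂ[X] →ₗ[ℂ] E), Integrable (fun a => L (p a)) μ ∧ L P = ∫ a, L (p a) ∂μ := by
  refine ⟨∑ k ∈ Finset.range n, (∫ a, (p a).coeff k ∂μ) • X ^ k, fun {E} _ _ _ L => ?_⟩
  have hterm : ∀ k ∈ Finset.range n, Integrable (fun a => (p a).coeff k • L (X ^ k)) μ :=
    fun k _ => (hint k).smul_const _
  simp_rw [fun a => map_eq_sum_coeff_smul (hdeg a) L]
  refine ⟨integrable_finsetSum _ hterm, ?_⟩
  rw [integral_finsetSum _ hterm]
  simp only [map_sum, map_smul, integral_smul_const]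

theorem CauchyDatum.integrable_coeff_cauchyInterpolant {α : Type*} [MeasurableSpace α]
    {μ : Measure α} {w φ : α → ℂ} (H : CauchyDatum μ w φ) {p : ℂ[X]} (hp : p.Monic)
    (hre : ∀ μ, p.IsRoot μ → 0 < μ.re) (k : ℕ) :
    Integrable (fun a => (φ a • cauchyInterpolant p (w a)).coeff k) μ := by
  obtain ⟨D, hD⟩ := exists_norm_coeff_cauchyInterpolant_le hp hre
  have hmeas : Measurable fun w => (cauchyInterpolant p w).coeff k := by
    simp_rw [coeff_cauchyInterpolant]
    exact p.continuous.measurable.inv.mul (by fun_prop)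
  simp_rw [coeff_smul]
  exact H.integrable_smul (H.aestronglyMeasurable_comp hmeas) fun a ha => hD _ ha k

theorem iteratedDeriv_polynomial_eval {𝕜 : Type*} [NontriviallyNormedField 𝕜] (P : 𝕜[X]) (j : ℕ) :
    iteratedDeriv j (fun z => P.eval z) = fun z => (derivative^[j] P).eval z := by
  induction j with
  | zero => simp
  | succ j ih =>
    rw [iteratedDeriv_succ, ih]
    ext z
    rw [Polynomial.deriv, Function.iterate_succ_apply']

theorem analyticAt_polynomial_eval (P : ℂ[X]) (z : ℂ) : AnalyticAt ℂ (fun z => P.eval z) z :=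
  P.differentiable.analyticAt z

theorem iteratedDeriv_polynomial_eval_mul_eq_zero {p : ℂ[X]} {g : ℂ → ℂ} {μ : ℂ}
    (hg : AnalyticAt ℂ g μ) {j : ℕ} (hj : j < p.rootMultiplicity μ) :
    iteratedDeriv j (fun z => p.eval z * g z) μ = 0 := by
  have hpg := (analyticAt_polynomial_eval p μ).mul hg
  obtain ⟨Q, hQ⟩ := pow_rootMultiplicity_dvd p μ
  refine (natCast_le_analyticOrderAt_iff_iteratedDeriv_eq_zero hpg).1
    ((natCast_le_analyticOrderAt hpg).2
      ⟨_, (analyticAt_polynomial_eval Q μ).mul hg, Eventually.of_forall fun z => ?_⟩) j hj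
  conv_lhs => rw [hQ]
  simp [mul_assoc]

variable {m : ℕ} {B : Matrix (Fin (m + 1)) (Fin (m + 1)) ℂ} {f g : ℂ → ℂ} {P Q : ℂ[X]}

namespace InterpolatesOnSpectrum

theorem of_eventuallyEq_add_charpoly_mul
    (h : ∀ μ, B.charpoly.IsRoot μ → AnalyticAt ℂ g μ ∧
      ∀ᶠ z in 𝓝 μ, f z = P.eval z + B.charpoly.eval z * g z) :
    InterpolatesOnSpectrum f B P := by
  intro μ hμ
  obtain ⟨hg, hf⟩ := h μ hμ
  have hr : AnalyticAt ℂ (fun z => B.charpoly.eval z * g z) μ :=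
    (analyticAt_polynomial_eval B.charpoly μ).mul hg
  refine ⟨((analyticAt_polynomial_eval P μ).add hr).congr (hf.mono fun z hz => hz.symm),
    fun j hj => ?_⟩
  rw [Filter.EventuallyEq.iteratedDeriv_eq j hf, iteratedDeriv_fun_add
    (analyticAt_polynomial_eval P μ).contDiffAt hr.contDiffAt, iteratedDeriv_polynomial_eval,
    iteratedDeriv_polynomial_eval_mul_eq_zero hg hj, add_zero]

theorem add (hf : InterpolatesOnSpectrum f B P) (hg : InterpolatesOnSpectrum g B Q) :
    InterpolatesOnSpectrum (fun z => f z + g z) B (P + Q) := by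
  intro μ hμ
  obtain ⟨hf1, hf2⟩ := hf μ hμ
  obtain ⟨hg1, hg2⟩ := hg μ hμ
  refine ⟨hf1.add hg1, fun j hj => ?_⟩
  rw [iterate_map_add, eval_add, hf2 j hj, hg2 j hj,
    iteratedDeriv_fun_add hf1.contDiffAt hg1.contDiffAt]

theorem congr (hf : InterpolatesOnSpectrum f B P)
    (h : ∀ μ, B.charpoly.IsRoot μ → f =ᶠ[𝓝 μ] g) : InterpolatesOnSpectrum g B P := by
  intro μ hμ
  obtain ⟨hf1, hf2⟩ := hf μ hμ
  refine ⟨hf1.congr (h μ hμ), fun j hj => ?_⟩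
  rw [hf2 j hj, (h μ hμ).iteratedDeriv_eq]

theorem rootMultiplicity_le (hP : InterpolatesOnSpectrum f B P) (hQ : InterpolatesOnSpectrum f B Q)
    (hne : P - Q ≠ 0) (μ : ℂ) :
    B.charpoly.rootMultiplicity μ ≤ (P - Q).rootMultiplicity μ := by
  rcases Nat.eq_zero_or_pos (B.charpoly.rootMultiplicity μ) with h | h
  · exact h ▸ Nat.zero_le _
  have hμ := (rootMultiplicity_pos B.charpoly_monic.ne_zero).1 h
  rw [← Nat.sub_add_cancel h, Nat.succ_le_iff,
    lt_rootMultiplicity_iff_isRoot_iterate_derivative hne]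
  intro j hj
  rw [IsRoot.def, iterate_derivative_sub, eval_sub, (hP μ hμ).2 j (by omega),
    (hQ μ hμ).2 j (by omega), sub_self]

theorem aeval_eq (hP : InterpolatesOnSpectrum f B P) (hQ : InterpolatesOnSpectrum f B Q) :
    aeval B P = aeval B Q := by
  rcases eq_or_ne (P - Q) 0 with h0 | h0
  · rw [sub_eq_zero.1 h0]
  obtain ⟨R, hR⟩ : B.charpoly ∣ P - Q := by
    rw [(IsAlgClosed.splits B.charpoly).eq_prod_roots_of_monic B.charpoly_monic,
      Multiset.prod_X_sub_C_dvd_iff_le_roots h0, Multiset.le_iff_count]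
    intro μ
    rw [count_roots, count_roots]
    exact hP.rootMultiplicity_le hQ h0 μ
  rw [← sub_eq_zero, ← map_sub, hR, map_mul, Matrix.aeval_self_charpoly, zero_mul]

theorem matrixFunction_eq (hP : InterpolatesOnSpectrum f B P) :
    matrixFunction f B = aeval B P := by
  have H : ∃ p : ℂ[X], InterpolatesOnSpectrum f B p := ⟨P, hP⟩
  rw [matrixFunction, dif_pos H]
  exact H.choose_spec.aeval_eq hP

end InterpolatesOnSpectrum

theorem CauchyDatum.exists_interpolatesOnSpectrum {α : Type*} [MeasurableSpace α] {μ : Measure α}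
    {w φ : α → ℂ} (H : CauchyDatum μ w φ) (hB : ∀ μ, B.charpoly.IsRoot μ → 0 < μ.re) :
    ∃ P : ℂ[X], InterpolatesOnSpectrum (fun z => ∫ a, φ a / (w a - z) ∂μ) B P ∧ ∀ i,
      aeval B P i = ∫ a, φ a • (w a • 1 - B)⁻¹ i ∂μ := by
  obtain ⟨D, hD⟩ := exists_norm_inv_eval_le B.charpoly_monic hB
  have H' : CauchyDatum μ w (fun a => φ a * (B.charpoly.eval (w a))⁻¹) :=
    H.mul_comp (g := fun z => (B.charpoly.eval z)⁻¹) B.charpoly.continuous.measurable.inv hD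
  obtain ⟨P, hP⟩ := exists_forall_map_eq_integral
    (fun a => (degree_smul_le (φ a) _).trans_lt
      (degree_cauchyInterpolant_lt B.charpoly_monic.ne_zero (w a)))
    (H.integrable_coeff_cauchyInterpolant B.charpoly_monic hB)
  refine ⟨P, .of_eventuallyEq_add_charpoly_mul
    (g := fun z => ∫ a, φ a * (B.charpoly.eval (w a))⁻¹ / (w a - z) ∂μ) fun ν hν =>
      ⟨H'.analyticAt (hB ν hν), ?_⟩, fun i => ?_⟩
  · filter_upwards [(isOpen_lt continuous_const continuous_re).mem_nhds (hB ν hν)] with z hz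
    obtain ⟨h1, h2⟩ := hP (leval z)
    rw [← leval_apply, h2, ← integral_const_mul,
      ← integral_add h1 ((H'.integrable_div hz).const_mul _)]
    refine integral_congr_ae ?_
    filter_upwards [H.re_nonpos] with a ha
    have hne : w a ≠ z := fun h => absurd (h ▸ ha) (not_le.2 hz)
    rw [leval_apply, eval_smul, smul_eq_mul, div_eq_mul_inv,
      inv_sub_eq_eval_cauchyInterpolant (eval_ne_zero_of_re_nonpos hB ha) hne]
    ring
  · rw [← aevalRow_apply, (hP (aevalRow B i)).2]
    refine integral_congr_ae ?_
    filter_upwards [H.re_nonpos] with a ha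
    rw [map_smul, aevalRow_apply, aeval_cauchyInterpolant B (eval_ne_zero_of_re_nonpos hB ha)]

end Interpolation

section Quadrant

/-- An even integrable majorant on the real line, singular like `|t|^{-1/2}` at the origin and
decaying like `|t|^{-3/2}`. -/
noncomputable def decayBound (t : ℝ) : ℝ := (√|t| * (1 + |t|))⁻¹

theorem decayBound_nonneg (t : ℝ) : 0 ≤ decayBound t := by unfold decayBound; positivity

theorem decayBound_anti {s t : ℝ} (hs : s ≠ 0) (h : |s| ≤ |t|) : decayBound t ≤ decayBound s := by
  unfold decayBound
  have : 0 < |s| := abs_pos.2 hs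
  gcongr

theorem measurable_decayBound : Measurable decayBound := by unfold decayBound; fun_prop

theorem decayBound_le_rpow_neg_half {t : ℝ} (ht : 0 < t) : decayBound t ≤ t ^ (-(1 / 2) : ℝ) := by
  rw [decayBound, abs_of_pos ht, Real.rpow_neg ht.le, ← Real.sqrt_eq_rpow]
  have := Real.sqrt_pos.2 ht
  gcongr
  exact le_mul_of_one_le_right this.le (by linarith)

theorem decayBound_le_rpow_neg_three_halves {t : ℝ} (ht : 0 < t) :
    decayBound t ≤ t ^ (-(3 / 2) : ℝ) := by
  rw [decayBound, abs_of_pos ht, Real.rpow_neg ht.le, show (3 / 2 : ℝ) = 1 / 2 + 1 by norm_num,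
    Real.rpow_add ht, ← Real.sqrt_eq_rpow, Real.rpow_one]
  have := Real.sqrt_pos.2 ht
  gcongr
  linarith

theorem integrableOn_Ioi_decayBound : IntegrableOn decayBound (Ioi 0) := by
  have mono : ∀ {S : Set ℝ} {p : ℝ}, MeasurableSet S → IntegrableOn (fun t : ℝ => t ^ p) S →
      (∀ t ∈ S, decayBound t ≤ t ^ p) → IntegrableOn decayBound S := fun hS hp h =>
    hp.mono' measurable_decayBound.aestronglyMeasurable <| (ae_restrict_iff' hS).2 <|
      Eventually.of_forall fun t ht => by
        rw [Real.norm_of_nonneg (decayBound_nonneg t)]; exact h t ht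
  rw [← Ioc_union_Ioi_eq_Ioi zero_le_one]
  refine (mono measurableSet_Ioc ?_ fun t ht => decayBound_le_rpow_neg_half ht.1).union
    (mono measurableSet_Ioi (integrableOn_Ioi_rpow_of_lt (by norm_num) zero_lt_one)
      fun t ht => decayBound_le_rpow_neg_three_halves (zero_lt_one.trans ht))
  exact (intervalIntegrable_iff_integrableOn_Ioc_of_le zero_le_one).1
    (intervalIntegral.intervalIntegrable_rpow' (by norm_num))

theorem integrable_decayBound : Integrable decayBound := by
  have h1 := integrableOn_Ioi_decayBound
  have h2 : IntegrableOn decayBound (Iic 0) := by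
    have h := (integrable_indicator_iff measurableSet_Ioi).2 h1
    rw [integrableOn_Iic_iff_integrableOn_Iio, ← integrable_indicator_iff measurableSet_Iio]
    exact h.comp_neg.congr (Eventually.of_forall fun t => by simp [indicator, decayBound])
  rw [← integrableOn_univ, ← Iic_union_Ioi (a := (0 : ℝ))]
  exact h2.union h1

theorem tendsto_intervalIntegral_of_dominated {E : Type*} [NormedAddCommGroup E] [NormedSpace ℝ E]
    {F : ℕ → ℝ → E} {f : ℝ → E} {b : ℝ → ℝ} {a r : ℕ → ℝ} {a₀ : ℝ} (ha : ∀ n, a₀ ≤ a n)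
    (har : ∀ n, a n ≤ r n) (ha' : Tendsto a atTop (𝓝 a₀)) (hr : Tendsto r atTop atTop)
    (hF : ∀ n, AEStronglyMeasurable (F n) (volume.restrict (Ioc (a n) (r n))))
    (hb : ∀ n, ∀ x ∈ Ioc (a n) (r n), x ≠ 0 → ‖F n x‖ ≤ b x)
    (hb0 : ∀ x, 0 ≤ b x) (hbi : Integrable b)
    (hlim : ∀ x, a₀ < x → x ≠ 0 → Tendsto (fun n => F n x) atTop (𝓝 (f x))) :
    IntegrableOn f (Ioi a₀) ∧
      Tendsto (fun n => ∫ x in a n..r n, F n x) atTop (𝓝 (∫ x in Ioi a₀, f x)) := by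
  have h0 : ∀ᵐ x : ℝ, x ≠ 0 := Measure.ae_ne volume 0
  have hm : ∀ n, AEStronglyMeasurable ((Ioc (a n) (r n)).indicator (F n))
      (volume.restrict (Ioi a₀)) := fun n =>
    AEStronglyMeasurable.restrict ((aestronglyMeasurable_indicator_iff measurableSet_Ioc).2 (hF n))
  have hbd : ∀ n, ∀ᵐ x ∂volume.restrict (Ioi a₀), ‖(Ioc (a n) (r n)).indicator (F n) x‖ ≤ b x := by
    intro n
    filter_upwards [ae_restrict_of_ae h0] with x hx
    by_cases h : x ∈ Ioc (a n) (r n)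
    · rw [indicator_of_mem h]; exact hb n x h hx
    · rw [indicator_of_notMem h, norm_zero]; exact hb0 x
  have hl : ∀ᵐ x ∂volume.restrict (Ioi a₀),
      Tendsto (fun n => (Ioc (a n) (r n)).indicator (F n) x) atTop (𝓝 (f x)) := by
    filter_upwards [ae_restrict_of_ae h0, ae_restrict_mem measurableSet_Ioi] with x hx hxa
    refine (hlim x hxa hx).congr' ?_
    filter_upwards [ha'.eventually (gt_mem_nhds hxa), hr.eventually_ge_atTop x] with n h1 h2
    rw [indicator_of_mem (show x ∈ Ioc (a n) (r n) from ⟨h1, h2⟩)]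
  constructor
  · refine hbi.integrableOn.mono' (aestronglyMeasurable_of_tendsto_ae atTop hm hl) ?_
    filter_upwards [hl, ae_all_iff.2 hbd] with x h1 h2
    exact le_of_tendsto h1.norm (Eventually.of_forall h2)
  · have := tendsto_integral_filter_of_dominated_convergence b (Eventually.of_forall hm)
      (Eventually.of_forall hbd) hbi.integrableOn hl
    refine this.congr fun n => ?_
    rw [intervalIntegral.integral_of_le (har n), setIntegral_indicator measurableSet_Ioc,
      inter_eq_self_of_subset_right]
    exact fun x hx => (ha n).trans_lt hx.1

theorem integral_rect_eq_zero {G : ℂ → ℂ} {s a R ε : ℝ} (hs : s = 1 ∨ s = -1) (ha : a ≤ R)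
    (hε : ε ≤ R) (hd : DifferentiableOn ℂ G {w | a ≤ w.re ∧ ε ≤ s * w.im}) :
    (∫ x in a..R, G (x + s * ε * I)) - (∫ x in a..R, G (x + s * R * I)) +
      s * I * (∫ y in ε..R, G (R + s * y * I)) - s * I * (∫ y in ε..R, G (a + s * y * I)) = 0 := by
  have hs0 : s ≠ 0 := by rcases hs with h | h <;> simp [h]
  have hss : (s : ℂ) * s = 1 := by rcases hs with h | h <;> simp [h]
  have hsub : uIcc a R ×ℂ uIcc (s * ε) (s * R) ⊆ {w | a ≤ w.re ∧ ε ≤ s * w.im} := by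
    rintro w ⟨hw1, hw2⟩
    rw [uIcc_of_le ha] at hw1
    refine ⟨hw1.1, ?_⟩
    rcases hs with rfl | rfl
    · rw [one_mul, one_mul, uIcc_of_le hε] at hw2
      simpa using hw2.1
    · rw [uIcc_of_ge (by linarith)] at hw2
      linarith [hw2.2]
  have key := integral_boundary_rect_eq_zero_of_differentiableOn G ⟨a, s * ε⟩ ⟨R, s * R⟩
    (hd.mono hsub)
  have orient : ∀ c : ℝ, s * (∫ y in s * ε..s * R, G (c + y * I)) =
      ∫ y in ε..R, G (c + s * y * I) := by
    intro c
    have h := intervalIntegral.integral_comp_mul_left (a := ε) (b := R)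
      (fun y : ℝ => G (c + y * I)) hs0
    simp only [ofReal_mul] at h
    rw [h, real_smul, ofReal_inv, inv_eq_of_mul_eq_one_left hss]
  simp only [smul_eq_mul] at key
  rw [← orient, ← orient]
  push_cast at key
  linear_combination key + (I * (∫ y in s * ε..s * R, G (R + y * I)) -
    I * (∫ y in s * ε..s * R, G (a + y * I))) * hss

/-- `G` is holomorphic on the quadrant `{w | -ξ ≤ Re w, 0 < s * Im w}`, `s = ±1`, up to its
vertical side, and has an integrable majorant there. -/
structure QuadrantDecay (G : ℂ → ℂ) (s ξ K : ℝ) : Prop where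
  sign : s = 1 ∨ s = -1
  nonneg : 0 ≤ K
  differentiableOn : DifferentiableOn ℂ G {w | -ξ ≤ w.re ∧ 0 < s * w.im}
  norm_le : ∀ w : ℂ, -ξ ≤ w.re → 0 < s * w.im → ‖G w‖ ≤ K * decayBound ‖w‖

namespace QuadrantDecay

variable {G : ℂ → ℂ} {g : ℝ → ℂ} {s ξ K x y R : ℝ}

theorem mul_im_eq (H : QuadrantDecay G s ξ K) (x y : ℝ) : s * ((x : ℂ) + s * y * I).im = y := by
  rcases H.sign with rfl | rfl <;> simp

theorem mem_quadrant (H : QuadrantDecay G s ξ K) (hx : -ξ ≤ x) (hy : 0 < y) :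
    (x : ℂ) + s * y * I ∈ {w : ℂ | -ξ ≤ w.re ∧ 0 < s * w.im} :=
  ⟨by simpa using hx, (H.mul_im_eq x y).symm ▸ hy⟩

theorem norm_le_decayBound_re (H : QuadrantDecay G s ξ K) (hx : -ξ ≤ x) (hx0 : x ≠ 0)
    (hy : 0 < y) : ‖G (x + s * y * I)‖ ≤ K * decayBound x := by
  obtain ⟨h1, h2⟩ := H.mem_quadrant hx hy
  refine (H.norm_le _ h1 h2).trans (mul_le_mul_of_nonneg_left (decayBound_anti hx0 ?_) H.nonneg)
  rw [abs_norm]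
  simpa using abs_re_le_norm ((x : ℂ) + s * y * I)

theorem norm_le_decayBound_im (H : QuadrantDecay G s ξ K) (hx : -ξ ≤ x) (hy : 0 < y) :
    ‖G (x + s * y * I)‖ ≤ K * decayBound y := by
  obtain ⟨h1, h2⟩ := H.mem_quadrant hx hy
  refine (H.norm_le _ h1 h2).trans
    (mul_le_mul_of_nonneg_left (decayBound_anti hy.ne' ?_) H.nonneg)
  have h := abs_im_le_norm ((x : ℂ) + s * y * I)
  rw [abs_norm]
  rcases H.sign with rfl | rfl <;> simpa using h

theorem continuousOn_horizontal (H : QuadrantDecay G s ξ K) (hy : 0 < y) :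
    ContinuousOn (fun x : ℝ => G (x + s * y * I)) (Ici (-ξ)) :=
  H.differentiableOn.continuousOn.comp (by fun_prop) fun _ hx => H.mem_quadrant hx hy

theorem continuousOn_vertical (H : QuadrantDecay G s ξ K) (hx : -ξ ≤ x) :
    ContinuousOn (fun y : ℝ => G (x + s * y * I)) (Ioi 0) :=
  H.differentiableOn.continuousOn.comp (by fun_prop) fun _ hy => H.mem_quadrant hx hy

theorem majorant_nonneg (H : QuadrantDecay G s ξ K) (x : ℝ) : 0 ≤ K * decayBound x :=
  mul_nonneg H.nonneg (decayBound_nonneg x)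

theorem majorant_mul_le (H : QuadrantDecay G s ξ K) (hξ : 0 < ξ) (hR : 0 < R) :
    K * decayBound R * (R + ξ) ≤ K * (1 + ξ) * (√R)⁻¹ := by
  rw [decayBound, abs_of_pos hR, mul_inv, mul_assoc, mul_assoc K (1 + ξ)]
  refine mul_le_mul_of_nonneg_left ?_ H.nonneg
  rw [mul_assoc, mul_comm]
  gcongr
  rw [inv_mul_le_iff₀ (by linarith)]
  nlinarith

theorem norm_integral_horizontal_le (H : QuadrantDecay G s ξ K) (hξ : 0 < ξ) (hR : 0 < R) :
    ‖∫ x in (-ξ)..R, G (x + s * R * I)‖ ≤ K * (1 + ξ) * (√R)⁻¹ := by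
  refine (intervalIntegral.norm_integral_le_of_norm_le_const (C := K * decayBound R)
    fun x hx => ?_).trans (le_trans (le_of_eq ?_) (H.majorant_mul_le hξ hR))
  · rw [uIoc_of_le (by linarith)] at hx
    exact H.norm_le_decayBound_im hx.1.le hR
  · rw [abs_of_nonneg (by linarith), sub_neg_eq_add]

theorem norm_integral_vertical_le (H : QuadrantDecay G s ξ K) (hξ : 0 < ξ) (hR : 1 ≤ R) :
    ‖∫ y in R⁻¹..R, G (R + s * y * I)‖ ≤ K * (1 + ξ) * (√R)⁻¹ := by
  have hR0 : 0 < R := one_pos.trans_le hR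
  have hinv : 0 < R⁻¹ := inv_pos.2 hR0
  have hle : R⁻¹ ≤ R := (inv_le_one_of_one_le₀ hR).trans hR
  refine (intervalIntegral.norm_integral_le_of_norm_le_const (C := K * decayBound R)
    fun y hy => ?_).trans (le_trans ?_ (H.majorant_mul_le hξ hR0))
  · rw [uIoc_of_le hle] at hy
    exact H.norm_le_decayBound_re (by linarith) hR0.ne' (hinv.trans hy.1)
  · refine mul_le_mul_of_nonneg_left ?_ (H.majorant_nonneg R)
    rw [abs_of_nonneg (by linarith)]
    linarith

theorem integral_boundary (H : QuadrantDecay G s ξ K) (hξ : 0 < ξ)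
    (hg : ∀ x : ℝ, -ξ < x → x ≠ 0 →
      Tendsto (fun ε : ℝ => G (x + s * ε * I)) (𝓝[>] 0) (𝓝 (g x))) :
    IntegrableOn g (Ioi (-ξ)) ∧ IntegrableOn (fun y : ℝ => G (-ξ + s * y * I)) (Ioi 0) ∧
      ∫ x in Ioi (-ξ), g x = s * I * ∫ y in Ioi (0 : ℝ), G (-ξ + s * y * I) := by
  set r : ℕ → ℝ := fun n => n + 1 with hr
  have hr1 : ∀ n, 1 ≤ r n := fun n => by simp [hr]
  have hr0 : ∀ n, 0 < r n := fun n => zero_lt_one.trans_le (hr1 n)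
  have hinv : ∀ n, 0 < (r n)⁻¹ := fun n => inv_pos.2 (hr0 n)
  have hξr : ∀ n, -ξ ≤ r n := fun n => by linarith [hr0 n]
  have hrl : ∀ n, (r n)⁻¹ ≤ r n := fun n => (inv_le_one_of_one_le₀ (hr1 n)).trans (hr1 n)
  have hrt : Tendsto r atTop atTop := tendsto_atTop_add_const_right _ _ tendsto_natCast_atTop_atTop
  have hri : Tendsto (fun n => (r n)⁻¹) atTop (𝓝 0) := hrt.inv_tendsto_atTop
  have hri' : Tendsto (fun n => (r n)⁻¹) atTop (𝓝[>] 0) :=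
    tendsto_nhdsWithin_iff.2 ⟨hri, Eventually.of_forall hinv⟩
  have hsq : Tendsto (fun n => K * (1 + ξ) * (√(r n))⁻¹) atTop (𝓝 0) := by
    simpa using (Real.tendsto_sqrt_atTop.comp hrt).inv_tendsto_atTop.const_mul (K * (1 + ξ))
  obtain ⟨int_near, near⟩ := tendsto_intervalIntegral_of_dominated
    (F := fun n x => G (x + s * ((r n)⁻¹ : ℝ) * I)) (fun _ => le_rfl) hξr tendsto_const_nhds hrt
    (fun n => ((H.continuousOn_horizontal (hinv n)).mono
      (Ioc_subset_Icc_self.trans Icc_subset_Ici_self)).aestronglyMeasurable measurableSet_Ioc)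
    (fun n x hx hx0 => H.norm_le_decayBound_re hx.1.le hx0 (hinv n)) H.majorant_nonneg
    (integrable_decayBound.const_mul K) fun x hx hx0 => (hg x hx hx0).comp hri'
  obtain ⟨int_left, left⟩ := tendsto_intervalIntegral_of_dominated
    (F := fun _ y => G ((-ξ : ℝ) + s * y * I)) (fun n => (hinv n).le) hrl hri hrt
    (fun n => ((H.continuousOn_vertical le_rfl).mono fun y hy =>
      (hinv n).trans hy.1).aestronglyMeasurable measurableSet_Ioc)
    (fun n y hy _ => H.norm_le_decayBound_im le_rfl ((hinv n).trans hy.1)) H.majorant_nonneg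
    (integrable_decayBound.const_mul K) fun y _ _ => tendsto_const_nhds
  have far := squeeze_zero_norm (fun n => H.norm_integral_horizontal_le hξ (hr0 n)) hsq
  have right := squeeze_zero_norm (fun n => H.norm_integral_vertical_le hξ (hr1 n)) hsq
  have hlim := ((near.sub far).add (right.const_mul (s * I))).sub (left.const_mul (s * I))
  have h0 := tendsto_nhds_unique (hlim.congr fun n => integral_rect_eq_zero H.sign (hξr n) (hrl n)
    (H.differentiableOn.mono fun w hw => ⟨hw.1, (hinv n).trans_le hw.2⟩)) tendsto_const_nhds
  rw [ofReal_neg] at int_left h0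
  exact ⟨int_near, int_left, by linear_combination h0⟩

end QuadrantDecay

end Quadrant

section CauchyRepresentation

variable {ξ : ℝ}

/-- The parametrization of the line `Re w = -ξ` by the imaginary part. -/
noncomputable def verticalLine (ξ y : ℝ) : ℂ := -(ξ : ℂ) + y * I

theorem verticalLine_re (ξ y : ℝ) : (verticalLine ξ y).re = -ξ := by simp [verticalLine]

theorem verticalLine_im (ξ y : ℝ) : (verticalLine ξ y).im = y := by simp [verticalLine]

theorem continuous_verticalLine (ξ : ℝ) : Continuous (verticalLine ξ) := by
  unfold verticalLine
  fun_prop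

theorem norm_verticalLine (ξ y : ℝ) : ‖verticalLine ξ y‖ = √(ξ ^ 2 + y ^ 2) := by
  rw [Complex.norm_def, normSq_apply, verticalLine_re, verticalLine_im]
  ring_nf

theorem abs_le_norm_verticalLine (ξ y : ℝ) : |y| ≤ ‖verticalLine ξ y‖ := by
  simpa [verticalLine_im] using abs_im_le_norm (verticalLine ξ y)

theorem verticalLine_mem_slitPlane (ξ : ℝ) {y : ℝ} (hy : y ≠ 0) : verticalLine ξ y ∈ slitPlane :=
  Or.inr (by rwa [verticalLine_im])

theorem integral_boundary_slit {G : ℂ → ℂ} {g : ℝ → ℝ → ℂ} {K : ℝ} (hξ : 0 < ξ)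
    (H : ∀ s : ℝ, s = 1 ∨ s = -1 → QuadrantDecay G s ξ K)
    (hg : ∀ s : ℝ, s = 1 ∨ s = -1 → ∀ x : ℝ, -ξ < x → x ≠ 0 →
      Tendsto (fun ε : ℝ => G (x + s * ε * I)) (𝓝[>] 0) (𝓝 (g s x))) :
    ∫ x in Ioi (-ξ), (g 1 x - g (-1) x) = I * ∫ y, G (verticalLine ξ y) := by
  obtain ⟨int_above, int_up, above⟩ := (H 1 (Or.inl rfl)).integral_boundary hξ (hg 1 (Or.inl rfl))
  obtain ⟨int_below, int_down, below⟩ :=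
    (H (-1) (Or.inr rfl)).integral_boundary hξ (hg (-1) (Or.inr rfl))
  simp only [ofReal_one, one_mul, ofReal_neg, neg_mul] at int_up above int_down below
  have int_lower : IntegrableOn (fun y : ℝ => G (-ξ + y * I)) (Iic 0) := by
    have h := ((integrable_indicator_iff measurableSet_Ioi).2 int_down).comp_neg
    rw [integrableOn_Iic_iff_integrableOn_Iio, ← integrable_indicator_iff measurableSet_Iio]
    exact h.congr (Eventually.of_forall fun y => by simp [indicator])
  have lower : ∫ y in Ioi (0 : ℝ), G (-ξ + -(y * I)) = ∫ y in Iic (0 : ℝ), G (-ξ + y * I) := by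
    simpa using integral_comp_neg_Ioi 0 fun y : ℝ => G (-ξ + y * I)
  have whole := intervalIntegral.integral_Iic_add_Ioi int_lower int_up
  rw [lower] at below
  rw [integral_sub int_above int_below, above, below]
  unfold verticalLine
  rw [← whole]
  ring

theorem integral_inv_sq_add_sub_sq {A : ℝ} (hA : 0 < A) (b : ℝ) :
    Integrable (fun y : ℝ => (A ^ 2 + (y - b) ^ 2)⁻¹) ∧
      ∫ y : ℝ, (A ^ 2 + (y - b) ^ 2)⁻¹ = Real.pi / A := by
  have scale : ∀ y : ℝ, (A ^ 2 + y ^ 2)⁻¹ = (A ^ 2)⁻¹ * (1 + (A⁻¹ * y) ^ 2)⁻¹ := by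
    intro y
    rw [← mul_inv]
    congr 1
    field_simp
  have hi : Integrable fun y : ℝ => (A ^ 2 + y ^ 2)⁻¹ := by
    simp_rw [scale]
    exact (integrable_inv_one_add_sq.comp_mul_left' (inv_ne_zero hA.ne')).const_mul _
  refine ⟨hi.comp_sub_right b, ?_⟩
  rw [integral_sub_right_eq_self (fun y : ℝ => (A ^ 2 + y ^ 2)⁻¹)]
  simp_rw [scale]
  rw [integral_const_mul, Measure.integral_comp_mul_left (fun y : ℝ => (1 + y ^ 2)⁻¹) A⁻¹,
    integral_univ_inv_one_add_sq, inv_inv, abs_of_pos hA, smul_eq_mul]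
  field_simp

theorem exists_norm_le_mul_decayBound {F : ℂ → ℂ} {S : Set ℂ} (hS : IsCompact S)
    (hF : ContinuousOn F S) :
    ∃ K : ℝ, 0 ≤ K ∧ ∀ w ∈ S, w ≠ 0 → ‖F w‖ ≤ K * decayBound ‖w‖ := by
  obtain ⟨K, hK⟩ := hS.exists_bound_of_continuousOn
    (f := fun w => ((√‖w‖ * (1 + ‖w‖) : ℝ) : ℂ) * F w) (by fun_prop)
  refine ⟨max K 0, le_max_right _ _, fun w hw hw0 => ?_⟩
  have hpos : 0 < √‖w‖ * (1 + ‖w‖) := by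
    have := Real.sqrt_pos.2 (norm_pos_iff.2 hw0)
    positivity
  have h := hK w hw
  rw [norm_mul, norm_real, Real.norm_of_nonneg hpos.le] at h
  rw [decayBound, abs_norm, ← div_eq_mul_inv, le_div_iff₀ hpos, mul_comm]
  exact h.trans (le_max_left _ _)

theorem div_sqrt_norm_div_le_decayBound {C t : ℝ} {w : ℂ} (hC : 0 ≤ C) (ht : t ≠ 0)
    (h : |t| ≤ ‖w‖) : C / √‖w‖ / (1 + ‖w‖) ≤ C * decayBound t := by
  have h1 := decayBound_anti ht (h.trans_eq (abs_norm w).symm)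
  rw [decayBound, abs_norm] at h1
  rw [div_div, div_eq_mul_inv]
  exact mul_le_mul_of_nonneg_left h1 hC

/-- `f` is holomorphic on `{w | -ξ ≤ Re w}` off the cut `(-∞, 0]`, is bounded by `C |w|^{-1/2}`
there, and has boundary values `b s t` at `-t` on the upper (`s = 1`) and the lower (`s = -1`) side
of the cut. -/
structure CutFunction (f : ℂ → ℂ) (b : ℝ → ℝ → ℂ) (ξ C : ℝ) : Prop where
  measurable : Measurable f
  measurable_boundary : ∀ s, Measurable (b s)
  differentiableAt : ∀ w ∈ slitPlane, -ξ ≤ w.re → DifferentiableAt ℂ f w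
  norm_le : ∀ w ∈ slitPlane, -ξ ≤ w.re → ‖f w‖ ≤ C / √‖w‖
  tendsto_boundary : ∀ s : ℝ, s = 1 ∨ s = -1 → ∀ t, 0 < t → t ≤ ξ →
    Tendsto (fun ε : ℝ => f (-t + s * ε * I)) (𝓝[>] 0) (𝓝 (b s t))

/-- The reflection of `z` in the line `Re w = -ξ`. -/
noncomputable def lineReflection (ξ : ℝ) (z : ℂ) : ℂ := ⟨-2 * ξ - z.re, z.im⟩

/-- The rational term removes the singularity of `f w / (w - z)` at `z` and makes the quotient
integrable at infinity; its own pole is the mirror image of `z` in the line `Re w = -ξ`. -/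
noncomputable def regularized (f : ℂ → ℂ) (ξ : ℝ) (z w : ℂ) : ℂ :=
  f w - f z * (z - lineReflection ξ z) / (w - lineReflection ξ z)

/-- The Cauchy kernel `regularized f ξ z w / (w - z)`, extended holomorphically to `w = z`. -/
noncomputable def cauchyKernel (f : ℂ → ℂ) (ξ : ℝ) (z : ℂ) : ℂ → ℂ := dslope (regularized f ξ z) z

theorem tendsto_add_mul_I_nhdsGT (t : ℂ) (s : ℝ) :
    Tendsto (fun ε : ℝ => t + s * ε * I) (𝓝[>] 0) (𝓝 t) := by
  have : ContinuousAt (fun ε : ℝ => t + s * ε * I) 0 := by fun_prop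
  simpa using this.tendsto.mono_left nhdsWithin_le_nhds

theorem ne_of_re_ne {w z : ℂ} (h : w.re ≠ z.re) : w ≠ z := fun e => h (congrArg re e)

section

variable {z w : ℂ} {f : ℂ → ℂ}

theorem re_lineReflection_lt (hξ : 0 < ξ) (hz : 0 < z.re) (hw : -ξ ≤ w.re) :
    (lineReflection ξ z).re < w.re := by
  simp only [lineReflection]
  linarith

theorem sub_lineReflection_ne_zero (hξ : 0 < ξ) (hz : 0 < z.re) (hw : -ξ ≤ w.re) :
    w - lineReflection ξ z ≠ 0 :=
  sub_ne_zero.2 (ne_of_re_ne (re_lineReflection_lt hξ hz hw).ne')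

theorem self_sub_lineReflection (ξ : ℝ) (z : ℂ) : z - lineReflection ξ z = 2 * (ξ + z.re) := by
  apply Complex.ext <;> simp [lineReflection]
  ring

theorem regularized_self (hξ : 0 < ξ) (hz : 0 < z.re) : regularized f ξ z z = 0 := by
  rw [regularized, mul_div_cancel_right₀ _ (sub_lineReflection_ne_zero hξ hz (by linarith)),
    sub_self]

theorem cauchyKernel_of_ne (hξ : 0 < ξ) (hz : 0 < z.re) (h : w ≠ z) :
    cauchyKernel f ξ z w = regularized f ξ z w / (w - z) := by
  rw [cauchyKernel, dslope_of_ne _ h, slope_def_field, regularized_self hξ hz, sub_zero]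

theorem cauchyKernel_verticalLine (hξ : 0 < ξ) (hz : 0 < z.re) (y : ℝ) :
    cauchyKernel f ξ z (verticalLine ξ y) = f (verticalLine ξ y) / (verticalLine ξ y - z) +
      f z * (2 * (ξ + z.re)) * (((ξ + z.re) ^ 2 + (y - z.im) ^ 2)⁻¹ : ℝ) := by
  have hprod : (verticalLine ξ y - lineReflection ξ z) * (verticalLine ξ y - z) =
      -(((ξ + z.re) ^ 2 + (y - z.im) ^ 2 : ℝ) : ℂ) := by
    apply Complex.ext <;>
      simp only [mul_re, mul_im, sub_re, sub_im, verticalLine_re, verticalLine_im, lineReflection,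
        neg_re, neg_im, ofReal_re, ofReal_im] <;> ring
  have hne : verticalLine ξ y ≠ z := ne_of_re_ne (by rw [verticalLine_re]; linarith)
  rw [cauchyKernel_of_ne hξ hz hne, regularized, self_sub_lineReflection, sub_div, div_div, hprod,
    div_neg, sub_neg_eq_add, div_eq_mul_inv (f z * _), ofReal_inv]

end

namespace CutFunction

variable {f : ℂ → ℂ} {b : ℝ → ℝ → ℂ} {C : ℝ} {z : ℂ}

theorem nonneg (H : CutFunction f b ξ C) (hξ : 0 ≤ ξ) : 0 ≤ C := by
  simpa using (norm_nonneg _).trans (H.norm_le 1 one_mem_slitPlane (by simp; linarith))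

theorem norm_boundary_le (H : CutFunction f b ξ C) {s t : ℝ} (hs : s = 1 ∨ s = -1) (ht : 0 < t)
    (htξ : t ≤ ξ) : ‖b s t‖ ≤ C / √t := by
  have hnorm : Tendsto (fun ε : ℝ => C / √‖-(t : ℂ) + s * ε * I‖) (𝓝[>] 0) (𝓝 (C / √t)) := by
    have h := (tendsto_add_mul_I_nhdsGT (-t) s).norm.sqrt
    rw [norm_neg, norm_real, Real.norm_of_nonneg ht.le] at h
    exact tendsto_const_nhds.div h (Real.sqrt_pos.2 ht).ne'
  refine le_of_tendsto_of_tendsto (H.tendsto_boundary s hs t ht htξ).norm hnorm ?_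
  filter_upwards [self_mem_nhdsWithin] with ε hε
  refine H.norm_le _ (Or.inr ?_) (by simpa using htξ)
  have : ε ≠ 0 := (mem_Ioi.1 hε).ne'
  rcases hs with rfl | rfl <;> simpa

theorem cauchyDatum_verticalLine (H : CutFunction f b ξ C) (hξ : 0 ≤ ξ) :
    CauchyDatum volume (verticalLine ξ) (fun y => -f (verticalLine ξ y) / (2 * Real.pi)) where
  measurable_curve := (continuous_verticalLine ξ).aestronglyMeasurable
  measurable_density := ((H.measurable.comp
    (continuous_verticalLine ξ).measurable).neg.div_const _).aestronglyMeasurable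
  re_nonpos := Eventually.of_forall fun y => by rw [verticalLine_re]; linarith
  integrable := by
    have hm : Measurable fun y => ‖-f (verticalLine ξ y) / (2 * Real.pi : ℂ)‖ /
        (1 + ‖verticalLine ξ y‖) :=
      ((H.measurable.comp (continuous_verticalLine ξ).measurable).neg.div_const _).norm.div
        ((continuous_verticalLine ξ).norm.measurable.const_add 1)
    refine (integrable_decayBound.const_mul C).mono' hm.aestronglyMeasurable ?_
    filter_upwards [Measure.ae_ne volume 0] with y hy
    have hπ : (1 : ℝ) ≤ ‖(2 * Real.pi : ℂ)‖ := by
      rw [norm_mul, norm_real, Real.norm_of_nonneg Real.pi_pos.le, RCLike.norm_ofNat]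
      linarith [Real.pi_gt_three]
    rw [Real.norm_of_nonneg (by positivity), norm_div, norm_neg]
    refine le_trans ?_ (div_sqrt_norm_div_le_decayBound (H.nonneg hξ) hy
      (abs_le_norm_verticalLine ξ y))
    exact div_le_div_of_nonneg_right ((div_le_self (norm_nonneg _) hπ).trans
      (H.norm_le _ (verticalLine_mem_slitPlane ξ hy) (verticalLine_re ξ y).ge)) (by positivity)

theorem cauchyDatum_cut (H : CutFunction f b ξ C) (hξ : 0 ≤ ξ) :
    CauchyDatum (volume.restrict (Ioc 0 ξ)) (fun t : ℝ => -(t : ℂ))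
      (fun t => (b 1 t - b (-1) t) / (2 * Real.pi * I)) where
  measurable_curve := (by fun_prop : Measurable fun t : ℝ => -(t : ℂ)).aestronglyMeasurable
  measurable_density :=
    (((H.measurable_boundary 1).sub (H.measurable_boundary (-1))).div_const _).aestronglyMeasurable
  re_nonpos := by
    filter_upwards [ae_restrict_mem measurableSet_Ioc] with t ht
    simpa using ht.1.le
  integrable := by
    have hm : Measurable fun t : ℝ => ‖(b 1 t - b (-1) t) / (2 * Real.pi * I)‖ / (1 + ‖-(t : ℂ)‖) :=
      (((H.measurable_boundary 1).sub (H.measurable_boundary (-1))).div_const _).norm.div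
        (by fun_prop)
    refine (integrable_decayBound.const_mul C).integrableOn.mono' hm.aestronglyMeasurable ?_
    filter_upwards [ae_restrict_mem measurableSet_Ioc] with t ⟨ht0, htξ⟩
    have ht : ‖-(t : ℂ)‖ = t := by rw [norm_neg, norm_real, Real.norm_of_nonneg ht0.le]
    have hjump : ‖b 1 t - b (-1) t‖ ≤ 2 * (C / √t) := by
      refine (norm_sub_le _ _).trans ?_
      rw [two_mul]
      exact add_le_add (H.norm_boundary_le (Or.inl rfl) ht0 htξ)
        (H.norm_boundary_le (Or.inr rfl) ht0 htξ)
    have hπ : ‖(2 * Real.pi * I : ℂ)‖ = 2 * Real.pi := by simp [abs_of_pos Real.pi_pos]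
    rw [Real.norm_of_nonneg (by positivity), norm_div, hπ]
    refine le_trans ?_ (div_sqrt_norm_div_le_decayBound (w := -(t : ℂ)) (H.nonneg hξ) ht0.ne'
      (by rw [ht, abs_of_pos ht0]))
    rw [ht]
    refine div_le_div_of_nonneg_right ?_ (by positivity)
    rw [div_le_iff₀ (by positivity)]
    have : 0 ≤ C / √t := div_nonneg (H.nonneg hξ) (Real.sqrt_nonneg t)
    nlinarith [Real.pi_gt_three]

theorem differentiableAt_regularized (H : CutFunction f b ξ C) (hξ : 0 < ξ) (hz : 0 < z.re) {w : ℂ}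
    (hw : w ∈ slitPlane) (hre : -ξ ≤ w.re) : DifferentiableAt ℂ (regularized f ξ z) w :=
  (H.differentiableAt w hw hre).sub <| (differentiableAt_const _).div
    (differentiableAt_id.sub_const _) (sub_lineReflection_ne_zero hξ hz hre)

theorem differentiableAt_cauchyKernel (H : CutFunction f b ξ C) (hξ : 0 < ξ) (hz : 0 < z.re) {w : ℂ}
    (hw : w ∈ slitPlane) (hre : -ξ ≤ w.re) : DifferentiableAt ℂ (cauchyKernel f ξ z) w := by
  rcases eq_or_ne w z with rfl | hne
  · have hnhds : {w : ℂ | 0 < w.re} ∈ 𝓝 w :=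
      (isOpen_lt continuous_const continuous_re).mem_nhds hz
    refine ((differentiableOn_dslope hnhds).2 fun v (hv : 0 < v.re) => ?_).differentiableAt hnhds
    exact (H.differentiableAt_regularized hξ hz (Or.inl hv) (by linarith)).differentiableWithinAt
  · exact (differentiableAt_dslope_of_ne hne).2 (H.differentiableAt_regularized hξ hz hw hre)

theorem exists_norm_regularized_le (H : CutFunction f b ξ C) (hξ : 0 < ξ) (hz : 0 < z.re) :
    ∃ L : ℝ, 0 ≤ L ∧ ∀ w ∈ slitPlane, -ξ ≤ w.re → ‖regularized f ξ z w‖ ≤ L / √‖w‖ := by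
  have hA : 0 < ξ + z.re := by positivity
  set k := (1 + ‖lineReflection ξ z‖) / (ξ + z.re) + 1
  set c := ‖f z * (z - lineReflection ξ z)‖ with hc
  have hC := H.nonneg hξ.le
  refine ⟨C + c * k, by positivity, fun w hw hre => ?_⟩
  have hdist : ξ + z.re ≤ ‖w - lineReflection ξ z‖ := by
    have h := (le_abs_self _).trans (abs_re_le_norm (w - lineReflection ξ z))
    simp only [sub_re, lineReflection] at h ⊢
    linarith
  have hsqrt : √‖w‖ ≤ 1 + ‖w‖ := Real.sqrt_le_iff.2 ⟨by positivity, by nlinarith [norm_nonneg w]⟩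
  rw [regularized, add_div]
  refine (norm_sub_le _ _).trans (add_le_add (H.norm_le w hw hre) ?_)
  rw [norm_div, ← hc, div_le_div_iff₀ (hA.trans_le hdist)
    (Real.sqrt_pos.2 (norm_pos_iff.2 (slitPlane_ne_zero hw))), mul_assoc]
  gcongr
  exact hsqrt.trans (one_add_norm_le_mul_norm_sub hA hdist)

theorem exists_norm_cauchyKernel_le (H : CutFunction f b ξ C) (hξ : 0 < ξ) (hz : 0 < z.re) :
    ∃ K : ℝ, 0 ≤ K ∧ ∀ w ∈ slitPlane, -ξ ≤ w.re →
      ‖cauchyKernel f ξ z w‖ ≤ K * decayBound ‖w‖ := by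
  set δ := z.re / 2 with hδ
  have hδ0 : 0 < δ := by positivity
  obtain ⟨K, hK0, near⟩ := exists_norm_le_mul_decayBound (isCompact_closedBall z δ)
    (F := cauchyKernel f ξ z) fun w hw => by
      have h := (abs_re_le_norm (w - z)).trans (mem_closedBall_iff_norm.1 hw)
      rw [sub_re, abs_le] at h
      exact (H.differentiableAt_cauchyKernel hξ hz (Or.inl (by linarith))
        (by linarith)).continuousAt.continuousWithinAt
  obtain ⟨L, hL0, hL⟩ := H.exists_norm_regularized_le hξ hz
  set k := (1 + ‖z‖) / δ + 1
  refine ⟨K + L * k, by positivity, fun w hw hre => ?_⟩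
  have hd := decayBound_nonneg ‖w‖
  rcases le_or_gt ‖w - z‖ δ with hwz | hwz
  · exact (near w (mem_closedBall_iff_norm.2 hwz) (slitPlane_ne_zero hw)).trans
      (mul_le_mul_of_nonneg_right (le_add_of_nonneg_right (by positivity)) hd)
  · have hpos := hδ0.trans hwz
    have hinv : ‖w - z‖⁻¹ ≤ k / (1 + ‖w‖) := by
      rw [inv_eq_one_div, div_le_div_iff₀ hpos (by positivity), one_mul]
      exact one_add_norm_le_mul_norm_sub hδ0 hwz.le
    rw [cauchyKernel_of_ne hξ hz (sub_ne_zero.1 (norm_pos_iff.1 hpos)), norm_div, div_eq_mul_inv]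
    calc ‖regularized f ξ z w‖ * ‖w - z‖⁻¹ ≤ L / √‖w‖ * (k / (1 + ‖w‖)) := by
          gcongr
          exact hL w hw hre
      _ = L * k * decayBound ‖w‖ := by rw [decayBound, abs_norm, mul_inv]; ring
      _ ≤ (K + L * k) * decayBound ‖w‖ := by gcongr; linarith

theorem exists_quadrantDecay (H : CutFunction f b ξ C) (hξ : 0 < ξ) (hz : 0 < z.re) :
    ∃ K, ∀ s : ℝ, s = 1 ∨ s = -1 → QuadrantDecay (cauchyKernel f ξ z) s ξ K := by
  obtain ⟨K, hK0, hK⟩ := H.exists_norm_cauchyKernel_le hξ hz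
  have hslit : ∀ {s : ℝ} {w : ℂ}, 0 < s * w.im → w ∈ slitPlane := fun h =>
    Or.inr (right_ne_zero_of_mul h.ne')
  exact ⟨K, fun s hs => ⟨hs, hK0, fun w hw => (H.differentiableAt_cauchyKernel hξ hz (hslit hw.2)
    hw.1).differentiableWithinAt, fun w hre him => hK w (hslit him) hre⟩⟩

theorem tendsto_cauchyKernel_cut (H : CutFunction f b ξ C) (hξ : 0 < ξ) (hz : 0 < z.re) {s t : ℝ}
    (hs : s = 1 ∨ s = -1) (ht : t < 0) (htξ : -ξ < t) :
    Tendsto (fun ε : ℝ => cauchyKernel f ξ z (t + s * ε * I)) (𝓝[>] 0)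
      (𝓝 ((b s (-t) - f z * (z - lineReflection ξ z) / (t - lineReflection ξ z)) / (t - z))) := by
  have hlin := tendsto_add_mul_I_nhdsGT (t : ℂ) s
  have htz : (t : ℂ) - z ≠ 0 := sub_ne_zero.2 (ne_of_re_ne (by rw [ofReal_re]; linarith))
  have hb := H.tendsto_boundary s hs (-t) (by linarith) (by linarith)
  rw [ofReal_neg, neg_neg] at hb
  refine ((hb.sub (tendsto_const_nhds.div (hlin.sub_const _)
    (sub_lineReflection_ne_zero hξ hz (by simpa using htξ.le)))).div (hlin.sub_const z) htz).congr
      fun ε => ?_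
  rw [cauchyKernel_of_ne hξ hz (ne_of_re_ne (by simp; linarith)), regularized]
  rfl

theorem integral_cut_eq (H : CutFunction f b ξ C) (hξ : 0 < ξ) (hz : 0 < z.re) :
    ∫ t in Ioc 0 ξ, (b 1 t - b (-1) t) / (-t - z) =
      I * ∫ y, cauchyKernel f ξ z (verticalLine ξ y) := by
  set g : ℝ → ℝ → ℂ := fun s t =>
    if t < 0 then (b s (-t) - f z * (z - lineReflection ξ z) / (t - lineReflection ξ z)) / (t - z)
    else cauchyKernel f ξ z t with hg
  obtain ⟨K, hK⟩ := H.exists_quadrantDecay hξ hz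
  have hlim : ∀ s : ℝ, s = 1 ∨ s = -1 → ∀ t : ℝ, -ξ < t → t ≠ 0 →
      Tendsto (fun ε : ℝ => cauchyKernel f ξ z (t + s * ε * I)) (𝓝[>] 0) (𝓝 (g s t)) := by
    intro s hs t htξ ht0
    rcases ht0.lt_or_gt with ht | ht
    · simpa only [hg, if_pos ht] using H.tendsto_cauchyKernel_cut hξ hz hs ht htξ
    · simp only [hg, if_neg ht.not_gt]
      exact (H.differentiableAt_cauchyKernel hξ hz (Or.inl ht)
        (by simpa using htξ.le)).continuousAt.tendsto.comp (tendsto_add_mul_I_nhdsGT t s)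
  have hjump : ∀ t : ℝ, g 1 t - g (-1) t =
      (Iio 0).indicator (fun t : ℝ => (b 1 (-t) - b (-1) (-t)) / (t - z)) t := by
    intro t
    by_cases ht : t < 0
    · rw [indicator_of_mem (mem_Iio.2 ht)]
      simp only [hg, if_pos ht]
      ring
    · rw [indicator_of_notMem (by simpa using ht)]
      simp only [hg, if_neg ht, sub_self]
  rw [← integral_boundary_slit hξ hK hlim]
  simp_rw [hjump]
  rw [setIntegral_indicator measurableSet_Iio, Ioi_inter_Iio, ← integral_Ioc_eq_integral_Ioo,
    ← intervalIntegral.integral_of_le hξ.le,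
    ← intervalIntegral.integral_of_le (neg_nonpos.2 hξ.le)]
  simpa using intervalIntegral.integral_comp_neg (a := 0) (b := ξ)
    fun t : ℝ => (b 1 (-t) - b (-1) (-t)) / ((t : ℂ) - z)

theorem integral_cauchyKernel_verticalLine (H : CutFunction f b ξ C) (hξ : 0 < ξ) (hz : 0 < z.re) :
    ∫ y, cauchyKernel f ξ z (verticalLine ξ y) =
      (∫ y, f (verticalLine ξ y) / (verticalLine ξ y - z)) + 2 * Real.pi * f z := by
  have hπ : (Real.pi : ℂ) ≠ 0 := ofReal_ne_zero.2 Real.pi_ne_zero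
  have hA : 0 < ξ + z.re := by positivity
  have hA' : (ξ + z.re : ℂ) ≠ 0 := by exact_mod_cast hA.ne'
  obtain ⟨hi, hv⟩ := integral_inv_sq_add_sub_sq hA z.im
  have hline : Integrable fun y => f (verticalLine ξ y) / (verticalLine ξ y - z) := by
    refine (((H.cauchyDatum_verticalLine hξ.le).integrable_div hz).const_mul
      (-(2 * Real.pi : ℂ))).congr (Eventually.of_forall fun y => ?_)
    field_simp
  have hPoisson : Integrable fun y : ℝ => ((((ξ + z.re) ^ 2 + (y - z.im) ^ 2)⁻¹ : ℝ) : ℂ) :=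
    hi.ofReal
  simp_rw [cauchyKernel_verticalLine hξ hz]
  rw [integral_add hline (hPoisson.const_mul _), integral_const_mul, integral_complex_ofReal, hv]
  push_cast
  field_simp

theorem eq_integral_cut_add_integral_line (H : CutFunction f b ξ C) (hξ : 0 < ξ) (hz : 0 < z.re) :
    f z = (∫ t in Ioc 0 ξ, (b 1 t - b (-1) t) / (2 * Real.pi * I) / (-t - z)) +
      ∫ y, -f (verticalLine ξ y) / (2 * Real.pi) / (verticalLine ξ y - z) := by
  have hπ : (Real.pi : ℂ) ≠ 0 := ofReal_ne_zero.2 Real.pi_ne_zero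
  have key := H.integral_cut_eq hξ hz
  rw [H.integral_cauchyKernel_verticalLine hξ hz] at key
  simp_rw [div_right_comm _ (2 * Real.pi * I : ℂ), div_right_comm _ (2 * Real.pi : ℂ), neg_div]
  rw [integral_div, integral_neg, integral_div, key]
  field_simp
  ring

end CutFunction

end CauchyRepresentation

section TransferFunction

variable {x ξ : ℝ} {w : ℂ}

theorem exp_neg_pi_mul_I_div_four :
    Complex.exp (-(Real.pi * I) / 4) = ((√2 / 2 : ℝ) : ℂ) * (1 - I) := by
  have h : -(Real.pi * I) / 4 = ((-(Real.pi / 4) : ℝ) : ℂ) * I := by push_cast; ring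
  rw [h, exp_mul_I, ← ofReal_cos, ← ofReal_sin, Real.cos_neg, Real.sin_neg, Real.cos_pi_div_four,
    Real.sin_pi_div_four]
  push_cast
  ring

theorem re_exp_neg_pi_mul_I_div_four_mul (w : ℂ) :
    (Complex.exp (-(Real.pi * I) / 4) * w).re = √2 / 2 * (w.re + w.im) := by
  rw [exp_neg_pi_mul_I_div_four, mul_assoc, re_ofReal_mul]
  simp

theorem norm_transferOfSqrt (d : ℝ) (w : ℂ) :
    ‖transferOfSqrt d w‖ =
      Real.exp (-d * (Complex.exp (-(Real.pi * I) / 4) * w).re) / (2 * ‖w‖) := by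
  have hrot : ‖Complex.exp (-(Real.pi * I) / 4)‖ = 1 := by
    rw [Complex.norm_exp]
    simp
  rw [transferOfSqrt, norm_div, norm_mul, norm_mul, hrot, Complex.norm_exp, neg_re, re_ofReal_mul,
    RCLike.norm_ofNat, one_mul, neg_mul]

theorem norm_cpow_half (w : ℂ) : ‖w ^ (1 / 2 : ℂ)‖ = √‖w‖ := by
  rw [eq_comm, Real.sqrt_eq_iff_mul_self_eq (norm_nonneg _) (norm_nonneg _), ← norm_mul, ← sq,
    one_div]
  exact congrArg norm (cpow_nat_inv_pow w two_ne_zero).symm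

theorem sqrt_two_div_two_mul_sqrt (ξ : ℝ) : √2 / 2 * √ξ = √(ξ / 2) := by
  rw [Real.sqrt_div' _ zero_le_two, Real.sqrt_div_self', one_div_mul_eq_div]

theorem sqrt_add_le_sqrt_add_sqrt {a b : ℝ} (ha : 0 ≤ a) (hb : 0 ≤ b) :
    √(a + b) ≤ √a + √b := by
  refine Real.sqrt_le_iff.2 ⟨by positivity, ?_⟩
  rw [add_sq, Real.sq_sqrt ha, Real.sq_sqrt hb]
  linarith [show 0 ≤ 2 * √a * √b by positivity]

theorem neg_sqrt_le_re_sqrt (hξ : 0 ≤ ξ) (hw : -ξ ≤ w.re) :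
    -√(ξ / 2) ≤ (Complex.exp (-(Real.pi * I) / 4) * w ^ (1 / 2 : ℂ)).re := by
  rw [re_exp_neg_pi_mul_I_div_four_mul, ← sqrt_two_div_two_mul_sqrt, ← mul_neg, one_div]
  refine mul_le_mul_of_nonneg_left ?_ (by positivity)
  have him : |(w ^ (2⁻¹ : ℂ)).im| ≤ (w ^ (2⁻¹ : ℂ)).re + √ξ :=
    calc |(w ^ (2⁻¹ : ℂ)).im| = √((‖w‖ - w.re) / 2) := abs_cpow_inv_two_im w
      _ ≤ √((‖w‖ + w.re) / 2 + ξ) := Real.sqrt_le_sqrt (by linarith)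
      _ ≤ √((‖w‖ + w.re) / 2) + √ξ :=
        sqrt_add_le_sqrt_add_sqrt (by linarith [neg_abs_le w.re, abs_re_le_norm w]) hξ
      _ = (w ^ (2⁻¹ : ℂ)).re + √ξ := by rw [cpow_inv_two_re]
  linarith [neg_abs_le (w ^ (2⁻¹ : ℂ)).im]

theorem sqrt_le_re_sqrt (hw : w.re = -ξ) (him : 0 ≤ w.im) :
    √(ξ / 2) ≤ (Complex.exp (-(Real.pi * I) / 4) * w ^ (1 / 2 : ℂ)).re := by
  rw [re_exp_neg_pi_mul_I_div_four_mul, ← sqrt_two_div_two_mul_sqrt, one_div, cpow_inv_two_re,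
    cpow_inv_two_im_eq_sqrt him]
  refine mul_le_mul_of_nonneg_left (le_add_of_nonneg_of_le (Real.sqrt_nonneg _) ?_)
    (by positivity)
  exact Real.sqrt_le_sqrt (by linarith [neg_abs_le w.re, abs_re_le_norm w])

theorem norm_transferFn (x : ℝ) (w : ℂ) : ‖transferFn x w‖ =
    Real.exp (-|x| * (Complex.exp (-(Real.pi * I) / 4) * w ^ (1 / 2 : ℂ)).re) / (2 * √‖w‖) := by
  rw [transferFn, norm_transferOfSqrt, norm_cpow_half]

theorem norm_transferFn_le (x : ℝ) (hξ : 0 ≤ ξ) (hw : -ξ ≤ w.re) :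
    ‖transferFn x w‖ ≤ Real.exp (|x| * √(ξ / 2)) / √‖w‖ := by
  have hexp : -|x| * (Complex.exp (-(Real.pi * I) / 4) * w ^ (1 / 2 : ℂ)).re ≤ |x| * √(ξ / 2) := by
    rw [neg_mul, ← mul_neg]
    exact mul_le_mul_of_nonneg_left (neg_le.1 (neg_sqrt_le_re_sqrt hξ hw)) (abs_nonneg x)
  rw [norm_transferFn, ← div_div]
  exact div_le_div_of_nonneg_right ((div_le_self (Real.exp_pos _).le one_le_two).trans
    (Real.exp_le_exp.2 hexp)) (Real.sqrt_nonneg _)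

theorem differentiableAt_transferOfSqrt (d : ℝ) (hw : w ≠ 0) :
    DifferentiableAt ℂ (transferOfSqrt d) w := by
  unfold transferOfSqrt
  exact DifferentiableAt.div (by fun_prop) (by fun_prop) (by simp [hw])

theorem differentiableAt_transferFn (x : ℝ) (hw : w ∈ slitPlane) :
    DifferentiableAt ℂ (transferFn x) w := by
  have hne : w ^ (1 / 2 : ℂ) ≠ 0 := cpow_ne_zero_iff.2 (Or.inl (slitPlane_ne_zero hw))
  exact (differentiableAt_transferOfSqrt |x| hne).comp (f := fun w => w ^ (1 / 2 : ℂ)) w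
    (differentiableAt_id.cpow (differentiableAt_const _) hw)

/-- The boundary value of `transferFn x` at the point `-l` of the cut, from above for `s = 1` and
from below for `s = -1`. -/
noncomputable def cutValue (x s l : ℝ) : ℂ :=
  transferOfSqrt |x| (√l * Complex.exp (s * (Real.pi * I / 2)))

theorem jumpFn_eq (x l : ℝ) : jumpFn x l = cutValue x (-1) l - cutValue x 1 l := by
  simp only [jumpFn, cutValue, ofReal_neg, ofReal_one, one_mul, neg_mul, neg_div]

theorem tendsto_log_cut {s t : ℝ} (hs : s = 1 ∨ s = -1) (ht : t < 0) :
    Tendsto (fun ε : ℝ => log (t + s * ε * I)) (𝓝[>] 0)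
      (𝓝 (Real.log (-t) + s * (Real.pi * I))) := by
  have hlin := tendsto_add_mul_I_nhdsGT (t : ℂ) s
  have hre : (t : ℂ).re < 0 := by simpa using ht
  have hnorm : ‖(t : ℂ)‖ = -t := by rw [norm_real, Real.norm_of_nonpos ht.le]
  have hpos : ∀ᶠ ε : ℝ in 𝓝[>] 0, 0 < ε := eventually_mem_nhdsWithin
  rcases hs with rfl | rfl
  · have h := tendsto_log_nhdsWithin_im_nonneg_of_re_neg_of_im_zero hre (ofReal_im t)
    rw [hnorm] at h
    rw [ofReal_one, one_mul]
    exact h.comp (tendsto_nhdsWithin_iff.2 ⟨hlin, hpos.mono fun ε hε => by simpa using hε.le⟩)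
  · have h := tendsto_log_nhdsWithin_im_neg_of_re_neg_of_im_zero hre (ofReal_im t)
    rw [hnorm] at h
    rw [ofReal_neg, ofReal_one, neg_one_mul, ← sub_eq_add_neg]
    refine h.comp (tendsto_nhdsWithin_iff.2 ⟨?_, hpos.mono fun ε hε => by simpa using hε⟩)
    simpa using hlin

theorem tendsto_transferFn_cut (x : ℝ) {s t : ℝ} (hs : s = 1 ∨ s = -1) (ht : t < 0) :
    Tendsto (fun ε : ℝ => transferFn x (t + s * ε * I)) (𝓝[>] 0) (𝓝 (cutValue x s (-t))) := by
  have hval : Complex.exp ((Real.log (-t) + s * (Real.pi * I)) * (1 / 2)) =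
      √(-t) * Complex.exp (s * (Real.pi * I / 2)) := by
    rw [show ((Real.log (-t) : ℂ) + s * (Real.pi * I)) * (1 / 2) =
      ((Real.log (-t) * (1 / 2) : ℝ) : ℂ) + s * (Real.pi * I / 2) by push_cast; ring,
      Complex.exp_add, ← ofReal_exp, ← Real.rpow_def_of_pos (neg_pos.2 ht), ← Real.sqrt_eq_rpow]
  have hpow : Tendsto (fun ε : ℝ => ((t : ℂ) + s * ε * I) ^ (1 / 2 : ℂ)) (𝓝[>] 0)
      (𝓝 (√(-t) * Complex.exp (s * (Real.pi * I / 2)))) := by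
    rw [← hval]
    refine ((continuous_exp.tendsto _).comp ((tendsto_log_cut hs ht).mul_const (1 / 2))).congr
      fun ε => ?_
    rw [Function.comp_apply, cpow_def_of_ne_zero]
    exact ne_of_re_ne (by simpa using ht.ne)
  refine (differentiableAt_transferOfSqrt |x| ?_).continuousAt.tendsto.comp hpow
  rw [← hval]
  exact Complex.exp_ne_zero _

theorem measurable_transferOfSqrt (d : ℝ) : Measurable (transferOfSqrt d) := by
  unfold transferOfSqrt
  fun_prop

theorem measurable_cutValue (x s : ℝ) : Measurable (cutValue x s) := by
  unfold cutValue
  exact (measurable_transferOfSqrt _).comp (by fun_prop)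

theorem cutFunction_transferFn (x : ℝ) (hξ : 0 ≤ ξ) :
    CutFunction (transferFn x) (cutValue x) ξ (Real.exp (|x| * √(ξ / 2))) where
  measurable := (measurable_transferOfSqrt |x|).comp (by fun_prop)
  measurable_boundary := measurable_cutValue x
  differentiableAt w hw _ := differentiableAt_transferFn x hw
  norm_le w _ hre := norm_transferFn_le x hξ hre
  tendsto_boundary s hs t ht _ := by
    simpa using tendsto_transferFn_cut x hs (neg_lt_zero.2 ht)

end TransferFunction

theorem iteratedDeriv_div_factorial_of_hasSum {f : ℂ → ℂ} {c : ℕ → ℂ}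
    (hf : ∀ ζ : ℂ, ‖ζ‖ < 1 → HasSum (fun n => ζ ^ n * c n) (f ζ)) (n : ℕ) :
    iteratedDeriv n f 0 / (n.factorial : ℂ) = c n := by
  have hball : HasFPowerSeriesOnBall f (.ofScalars ℂ c) 0 1 := by
    refine ⟨le_of_forall_lt_imp_le_of_dense fun ρ hρ => ?_, zero_lt_one, fun {y} hy => ?_⟩
    · lift ρ to NNReal using hρ.ne_top
      apply FormalMultilinearSeries.le_radius_of_summable
      have hρ' : ‖((ρ : ℝ) : ℂ)‖ < 1 := by simpa using hρ
      simpa [norm_mul, mul_comm] using (hf _ hρ').summable.norm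
    · rw [← ENNReal.coe_one, Metric.eball_coe, NNReal.coe_one, mem_ball_zero_iff] at hy
      simpa [mul_comm] using hf y hy
  have hunique := hball.hasFPowerSeriesAt.eq_formalMultilinearSeries
    hball.hasFPowerSeriesAt.analyticAt.hasFPowerSeriesAt
  have hcoeff := congrArg (fun p : FormalMultilinearSeries ℂ ℂ ℂ => p.coeff n) hunique
  simp only [FormalMultilinearSeries.coeff_ofScalars] at hcoeff
  exact hcoeff.symm

theorem measurable_matrix_inv_apply {ι : Type*} [Fintype ι] [DecidableEq ι] {F : ℂ → Matrix ι ι ℂ}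
    (hF : Continuous F) (i j : ι) : Measurable fun z => (F z)⁻¹ i j := by
  simp_rw [Matrix.inv_def, Ring.inverse_eq_inv', Matrix.smul_apply, smul_eq_mul]
  exact hF.matrix_det.measurable.inv.mul (hF.matrix_adjugate.matrix_elem i j).measurable

theorem re_ofReal_mul_nonpos {h : ℝ} (hh : 0 < h) {w : ℂ} (hw : w.re ≤ 0) :
    ((h : ℂ) * w).re ≤ 0 := by
  rw [re_ofReal_mul]
  exact mul_nonpos_of_nonneg_of_nonpos hh.le hw

namespace RungeKutta

variable {m : ℕ} {M : RungeKutta m}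

theorem measurable_q (M : RungeKutta m) : Measurable M.q := by
  have hinv := measurable_matrix_inv_apply (F := fun z => 1 - z • M.Ac) (by fun_prop)
  exact measurable_pi_iff.2 fun j =>
    Finset.measurable_fun_sum Finset.univ fun i _ => (hinv i j).const_mul (M.bc i)

theorem measurable_r (M : RungeKutta m) : Measurable M.r :=
  (measurable_id.mul (Finset.measurable_fun_sum _ fun j _ =>
    ((measurable_pi_apply j).comp M.measurable_q).mul_const 1)).const_add 1

/-- An `A`-stable, stiffly accurate method with invertible coefficient matrix; `A`-stability
includes the invertibility of `I - z A` for `Re z ≤ 0`. -/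
structure StifflyAStable (M : RungeKutta m) : Prop where
  nonsingular : ∀ z : ℂ, z.re ≤ 0 → IsUnit (1 - z • M.Ac)
  norm_r_le : ∀ z : ℂ, z.re ≤ 0 → ‖M.r z‖ ≤ 1
  invertible : IsUnit M.A
  stiffly_accurate : Matrix.vecMul M.b M.A⁻¹ = Pi.single (Fin.last m) 1

theorem Admissible.stifflyAStable (hM : M.Admissible) : M.StifflyAStable :=
  ⟨hM.nonsingular, hM.norm_r_le, hM.invertible, hM.stiffly_accurate⟩

/-- The rank-one matrix `𝟙 e_sᵀ`, through which the symbol of a stiffly accurate method depends on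
`ζ`. -/
def onesLast (m : ℕ) : Matrix (Fin (m + 1)) (Fin (m + 1)) ℂ :=
  Matrix.vecMulVec (fun _ => 1) (Pi.single (Fin.last m) 1)

theorem onesLast_mul_self : onesLast m * onesLast m = onesLast m := by
  rw [onesLast, Matrix.vecMulVec_mul_vecMulVec]
  simp

theorem onesLast_mul (B : Matrix (Fin (m + 1)) (Fin (m + 1)) ℂ) :
    onesLast m * B = Matrix.vecMulVec (fun _ => 1) (B (Fin.last m)) := by
  rw [onesLast, Matrix.vecMulVec_mul, Matrix.single_one_vecMul]
  rfl

theorem vecMul_onesLast (v : Fin (m + 1) → ℂ) :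
    Matrix.vecMul v (onesLast m) = (v ⬝ᵥ fun _ => 1) • Pi.single (Fin.last m) 1 :=
  Matrix.vecMul_vecMulVec _ _ _

theorem onesLast_mulVec (v : Fin (m + 1) → ℂ) :
    (onesLast m).mulVec v = v (Fin.last m) • fun _ => 1 := by
  rw [onesLast, Matrix.vecMulVec_mulVec, single_one_dotProduct, op_smul_eq_smul]

theorem smul_one_sub_smul_symbol (M : RungeKutta m) {h : ℝ} (hh : h ≠ 0) (w ζ : ℂ) :
    w • 1 - (h : ℂ)⁻¹ • M.symbol ζ = (-(h : ℂ)⁻¹) • (M.symbol ζ - ((h : ℂ) * w) • 1) := by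
  rw [smul_sub, smul_smul, ← mul_assoc, neg_mul, inv_mul_cancel₀ (ofReal_ne_zero.2 hh), neg_one_mul,
    neg_smul, neg_smul, sub_neg_eq_add, neg_add_eq_sub]

namespace StifflyAStable

theorem isUnit_det_Ac (hM : M.StifflyAStable) : IsUnit M.Ac.det :=
  (Matrix.isUnit_iff_isUnit_det _).1
    (hM.invertible.map (Complex.ofRealHom.mapMatrix (m := Fin (m + 1))))

theorem bc_eq (hM : M.StifflyAStable) : M.bc = M.Ac (Fin.last m) := by
  have hb : M.b = M.A (Fin.last m) :=
    calc M.b = Matrix.vecMul (Matrix.vecMul M.b M.A⁻¹) M.A := by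
          rw [Matrix.vecMul_vecMul, Matrix.nonsing_inv_mul _
            ((Matrix.isUnit_iff_isUnit_det _).1 hM.invertible), Matrix.vecMul_one]
      _ = M.A (Fin.last m) := by rw [hM.stiffly_accurate, Matrix.single_one_vecMul]; rfl
  ext j
  rw [bc, hb, Ac, Matrix.map_apply]

theorem q_sub_smul_vecMul (hM : M.StifflyAStable) {z : ℂ} (hz : z.re ≤ 0) :
    M.q z - z • Matrix.vecMul (M.q z) M.Ac = M.bc := by
  have h : Matrix.vecMul (M.q z) (1 - z • M.Ac) = M.bc := by
    rw [q, Matrix.vecMul_vecMul, Matrix.nonsing_inv_mul _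
      ((Matrix.isUnit_iff_isUnit_det _).1 (hM.nonsingular z hz)), Matrix.vecMul_one]
  rwa [Matrix.vecMul_sub, Matrix.vecMul_one, Matrix.vecMul_smul] at h

theorem q_vecMul_inv (hM : M.StifflyAStable) {z : ℂ} (hz : z.re ≤ 0) :
    Matrix.vecMul (M.q z) M.Ac⁻¹ = Pi.single (Fin.last m) 1 + z • M.q z := by
  have h : M.q z = Matrix.vecMul (Pi.single (Fin.last m) 1 + z • M.q z) M.Ac := by
    rw [Matrix.add_vecMul, Matrix.single_one_vecMul, Matrix.smul_vecMul]
    exact (sub_eq_iff_eq_add.1 (hM.q_sub_smul_vecMul hz)).trans (by rw [hM.bc_eq]; rfl)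
  conv_lhs => rw [h, Matrix.vecMul_vecMul, Matrix.mul_nonsing_inv _ hM.isUnit_det_Ac,
    Matrix.vecMul_one]

theorem r_eq (hM : M.StifflyAStable) {z : ℂ} (hz : z.re ≤ 0) :
    M.r z = Matrix.vecMul (M.q z) M.Ac⁻¹ ⬝ᵥ fun _ => 1 := by
  rw [hM.q_vecMul_inv hz, add_dotProduct, single_one_dotProduct, smul_dotProduct, r, smul_eq_mul]

theorem symbol_eq (hM : M.StifflyAStable) {ζ : ℂ} (hζ : ζ ≠ 1) :
    M.symbol ζ = M.Ac⁻¹ * (1 - ζ • onesLast m) := by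
  have hζ' : 1 - ζ ≠ 0 := sub_ne_zero.2 hζ.symm
  have hinv : (1 + (ζ / (1 - ζ)) • onesLast m) * (1 - ζ • onesLast m) = 1 := by
    simp only [add_mul, mul_sub, mul_one, one_mul, Matrix.smul_mul, Matrix.mul_smul,
      onesLast_mul_self]
    rw [smul_smul, ← add_smul, add_sub_assoc, ← sub_smul]
    have : ζ / (1 - ζ) - (ζ + ζ * (ζ / (1 - ζ))) = 0 := by field_simp; ring
    rw [this, zero_smul, add_zero]
  have hfac : M.Ac + (ζ / (1 - ζ)) • Matrix.vecMulVec (fun _ => 1) M.bc =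
      (1 + (ζ / (1 - ζ)) • onesLast m) * M.Ac := by
    rw [add_mul, one_mul, Matrix.smul_mul, onesLast_mul, hM.bc_eq]
  rw [symbol, hfac, Matrix.mul_inv_rev, Matrix.inv_eq_right_inv hinv]

theorem one_sub_mul_r_ne_zero (hM : M.StifflyAStable) {z ζ : ℂ} (hz : z.re ≤ 0) (hζ : ‖ζ‖ < 1) :
    1 - ζ * M.r z ≠ 0 := by
  have h : ‖ζ * M.r z‖ < 1 := by
    rw [norm_mul]
    exact mul_lt_one_of_nonneg_of_lt_one_left (norm_nonneg _) hζ (hM.norm_r_le z hz)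
  refine sub_ne_zero.2 fun h1 => ?_
  rw [← h1, norm_one] at h
  exact h.false

theorem q_vecMul_symbol_sub (hM : M.StifflyAStable) {z ζ : ℂ} (hz : z.re ≤ 0) (hζ : ‖ζ‖ < 1) :
    Matrix.vecMul (M.q z) (M.symbol ζ - z • 1) =
      (1 - ζ * M.r z) • Pi.single (Fin.last m) 1 := by
  rw [hM.symbol_eq (by rintro rfl; simp at hζ), Matrix.vecMul_sub, Matrix.vecMul_smul,
    Matrix.vecMul_one, ← Matrix.vecMul_vecMul, Matrix.vecMul_sub, Matrix.vecMul_one,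
    Matrix.vecMul_smul, vecMul_onesLast, ← hM.r_eq hz, hM.q_vecMul_inv hz, sub_smul, mul_smul,
    one_smul]
  abel

theorem isUnit_symbol_sub (hM : M.StifflyAStable) {z ζ : ℂ} (hz : z.re ≤ 0) (hζ : ‖ζ‖ < 1) :
    IsUnit (M.symbol ζ - z • 1) := by
  rw [Matrix.isUnit_iff_isUnit_det, isUnit_iff_ne_zero]
  intro hdet
  obtain ⟨v, hv0, hv⟩ := Matrix.exists_mulVec_eq_zero_iff.2 hdet
  have hlast : v (Fin.last m) = 0 := by
    have h := congrArg (M.q z ⬝ᵥ ·) hv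
    simp only [Matrix.dotProduct_mulVec, hM.q_vecMul_symbol_sub hz hζ, smul_dotProduct,
      single_one_dotProduct, dotProduct_zero, smul_eq_mul] at h
    exact (mul_eq_zero.1 h).resolve_left (hM.one_sub_mul_r_ne_zero hz hζ)
  refine hv0 (Matrix.mulVec_injective_of_isUnit (hM.nonsingular z hz) ?_)
  have hker := congrArg M.Ac.mulVec hv
  rw [hM.symbol_eq (by rintro rfl; simp at hζ), Matrix.mulVec_mulVec, mul_sub, ← mul_assoc,
    Matrix.mul_nonsing_inv _ hM.isUnit_det_Ac, one_mul, Matrix.mul_smul, mul_one, Matrix.sub_mulVec,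
    Matrix.sub_mulVec, Matrix.smul_mulVec, onesLast_mulVec, hlast, zero_smul, smul_zero,
    sub_zero, Matrix.mulVec_zero, ← Matrix.sub_mulVec] at hker
  rw [hker, Matrix.mulVec_zero]

theorem inv_symbol_sub_last (hM : M.StifflyAStable) {z ζ : ℂ} (hz : z.re ≤ 0) (hζ : ‖ζ‖ < 1) :
    (M.symbol ζ - z • 1)⁻¹ (Fin.last m) = (1 - ζ * M.r z)⁻¹ • M.q z := by
  have hdet := (Matrix.isUnit_iff_isUnit_det _).1 (hM.isUnit_symbol_sub hz hζ)
  have hq : M.q z = (1 - ζ * M.r z) • (M.symbol ζ - z • 1)⁻¹ (Fin.last m) :=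
    calc M.q z = Matrix.vecMul (Matrix.vecMul (M.q z) (M.symbol ζ - z • 1))
          (M.symbol ζ - z • 1)⁻¹ := by
          rw [Matrix.vecMul_vecMul, Matrix.mul_nonsing_inv _ hdet, Matrix.vecMul_one]
      _ = _ := by
          rw [hM.q_vecMul_symbol_sub hz hζ, Matrix.smul_vecMul, Matrix.single_one_vecMul]
          rfl
  conv_rhs => rw [hq]
  rw [inv_smul_smul₀ (hM.one_sub_mul_r_ne_zero hz hζ)]

theorem hasSum_eVec (hM : M.StifflyAStable) {z ζ : ℂ} (hz : z.re ≤ 0) (hζ : ‖ζ‖ < 1) :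
    HasSum (fun n => ζ ^ n • M.r z ^ n • M.q z) ((M.symbol ζ - z • 1)⁻¹ (Fin.last m)) := by
  rw [hM.inv_symbol_sub_last hz hζ]
  have h : ‖ζ * M.r z‖ < 1 := by
    rw [norm_mul]
    exact mul_lt_one_of_nonneg_of_lt_one_left (norm_nonneg _) hζ (hM.norm_r_le z hz)
  simpa only [mul_pow, mul_smul] using (hasSum_geometric_of_norm_lt_one h).smul_const (M.q z)

theorem eVec_eq (hM : M.StifflyAStable) (n : ℕ) {z : ℂ} (hz : z.re ≤ 0) :
    M.eVec n z = M.r z ^ n • M.q z := by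
  ext j
  exact iteratedDeriv_div_factorial_of_hasSum (c := fun n => (M.r z ^ n • M.q z) j)
    (fun ζ hζ => (Pi.hasSum.1 (hM.hasSum_eVec hz hζ)) j) n

theorem re_pos_of_isRoot_charpoly (hM : M.StifflyAStable) {h : ℝ} (hh : 0 < h) {ζ : ℂ}
    (hζ : ‖ζ‖ < 1) {μ : ℂ} (hμ : ((h : ℂ)⁻¹ • M.symbol ζ).charpoly.IsRoot μ) : 0 < μ.re := by
  by_contra! hre
  have hdet := (Matrix.isUnit_iff_isUnit_det _).1
    (hM.isUnit_symbol_sub (re_ofReal_mul_nonpos hh hre) hζ)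
  have hh' : -(h : ℂ)⁻¹ ≠ 0 := neg_ne_zero.2 (inv_ne_zero (ofReal_ne_zero.2 hh.ne'))
  rw [IsRoot.def, Matrix.eval_charpoly, Matrix.scalar_apply, ← Matrix.smul_one_eq_diagonal,
    smul_one_sub_smul_symbol M hh.ne', Matrix.det_smul, mul_eq_zero] at hμ
  exact hμ.elim (pow_ne_zero _ hh') hdet.ne_zero

theorem inv_smul_one_sub_smul_symbol_last (hM : M.StifflyAStable) {h : ℝ} (hh : 0 < h) {w ζ : ℂ}
    (hw : w.re ≤ 0) (hζ : ‖ζ‖ < 1) :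
    (w • 1 - (h : ℂ)⁻¹ • M.symbol ζ)⁻¹ (Fin.last m) =
      -(h : ℂ) • (M.symbol ζ - ((h : ℂ) * w) • 1)⁻¹ (Fin.last m) := by
  have hdet := (Matrix.isUnit_iff_isUnit_det _).1
    (hM.isUnit_symbol_sub (re_ofReal_mul_nonpos hh hw) hζ)
  have hh' : (h : ℂ) ≠ 0 := ofReal_ne_zero.2 hh.ne'
  have hinv : (w • 1 - (h : ℂ)⁻¹ • M.symbol ζ)⁻¹ =
      -(h : ℂ) • (M.symbol ζ - ((h : ℂ) * w) • 1)⁻¹ := by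
    refine Matrix.inv_eq_right_inv ?_
    rw [smul_one_sub_smul_symbol M hh.ne', Matrix.smul_mul, Matrix.mul_smul, smul_smul,
      neg_mul_neg, inv_mul_cancel₀ hh', one_smul, Matrix.mul_nonsing_inv _ hdet]
  rw [hinv]
  rfl

theorem exists_norm_q_le (hM : M.StifflyAStable) :
    ∃ D : ℝ, ∀ z : ℂ, z.re ≤ 0 → ‖M.q z‖ ≤ D / (1 + ‖z‖) := by
  have h0 : ‖(0 : ℂ)‖ < 1 := by simp
  obtain ⟨D, hD⟩ := exists_norm_resolvent_le
    (fun μ => hM.re_pos_of_isRoot_charpoly one_pos h0 (μ := μ)) (Fin.last m)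
  refine ⟨D, fun z hz => ?_⟩
  have h := hD z hz
  rwa [hM.inv_smul_one_sub_smul_symbol_last one_pos hz h0,
    hM.inv_symbol_sub_last (re_ofReal_mul_nonpos one_pos hz) h0, zero_mul, sub_zero, inv_one,
    one_smul, ofReal_one, one_mul, neg_one_smul, norm_neg] at h

end StifflyAStable

end RungeKutta

section SeminormIntegral

variable {E : Type*} [NormedAddCommGroup E] [NormedSpace ℂ E]

theorem continuous_seminorm_of_finiteDimensional [FiniteDimensional ℂ E] (N : Seminorm ℂ E) :
    Continuous N := by
  have : FiniteDimensional ℝ E := FiniteDimensional.complexToReal E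
  exact (N.restrictScalars ℝ).convexOn.locallyLipschitz.continuous

variable {N : Seminorm ℂ E} {α : Type*} [MeasurableSpace α] {μ : Measure α} {v : α → E}

theorem integrable_seminorm_comp (hN : Continuous N) (hv : Integrable v μ) :
    Integrable (fun a => N (v a)) μ := by
  obtain ⟨K, -, hK⟩ := Seminorm.bound_of_continuous_normedSpace N hN
  exact (hv.norm.const_mul K).mono' (hN.comp_aestronglyMeasurable hv.aestronglyMeasurable)
    (Eventually.of_forall fun a => by
      simpa only [Real.norm_of_nonneg (apply_nonneg N _)] using hK _)

theorem exists_dual_apply_eq_seminorm (hN : Continuous N) (v₀ : E) :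
    ∃ g : StrongDual ℂ E, g v₀ = N v₀ ∧ ∀ u, ‖g u‖ ≤ N u := by
  rcases eq_or_ne v₀ 0 with rfl | h0
  · exact ⟨0, by simp, fun u => by simp⟩
  set coord : (ℂ ∙ v₀) →ₗ[ℂ] ℂ := (LinearEquiv.coord ℂ E v₀ h0).toLinearMap
  have hle : ∀ u : ℂ ∙ v₀, ‖((N v₀ : ℂ) • coord) u‖ ≤ N u := fun u => by
    conv_rhs => rw [← LinearEquiv.coord_apply_smul ℂ E v₀ h0 u, map_smul_eq_mul, mul_comm]
    rw [LinearMap.smul_apply, norm_smul, norm_real, Real.norm_of_nonneg (apply_nonneg N _)]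
    rfl
  obtain ⟨g, hg, hgN⟩ := Module.Dual.exists_continuous_extension_of_le_seminorm _ _ hN hle
  refine ⟨g, (hg ⟨v₀, Submodule.mem_span_singleton_self v₀⟩).trans ?_, hgN⟩
  rw [LinearMap.smul_apply, LinearEquiv.coe_toLinearMap, LinearEquiv.coord_self, smul_eq_mul,
    mul_one]

theorem seminorm_integral_le [CompleteSpace E] (hN : Continuous N) (hv : Integrable v μ) :
    N (∫ a, v a ∂μ) ≤ ∫ a, N (v a) ∂μ := by
  obtain ⟨g, hg, hgN⟩ := exists_dual_apply_eq_seminorm hN (∫ a, v a ∂μ)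
  calc N (∫ a, v a ∂μ) = ‖g (∫ a, v a ∂μ)‖ := by
        rw [hg, norm_real, Real.norm_of_nonneg (apply_nonneg N _)]
    _ = ‖∫ a, g (v a) ∂μ‖ := by rw [g.integral_comp_comm hv]
    _ ≤ ∫ a, N (v a) ∂μ := norm_integral_le_of_norm_le (integrable_seminorm_comp hN hv)
        (Eventually.of_forall fun a => hgN (v a))

end SeminormIntegral

namespace RungeKutta

variable {m : ℕ} {M : RungeKutta m}

theorem StifflyAStable.exists_isDecayConstant (hM : M.StifflyAStable)
    (N : Seminorm ℂ (Fin (m + 1) → ℂ)) : ∃ C : ℝ, M.IsDecayConstant N C := by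
  obtain ⟨D, hD⟩ := hM.exists_norm_q_le
  obtain ⟨K, hK0, hK⟩ :=
    Seminorm.bound_of_continuous_normedSpace N (continuous_seminorm_of_finiteDimensional N)
  set u := M.Ac⁻¹.mulVec fun _ => 1
  have hr : ∀ z : ℂ, z.re ≤ 0 → ‖M.r z‖ ≤ (∑ i, ‖u i‖) * ‖M.q z‖ := fun z hz => by
    rw [hM.r_eq hz, ← Matrix.dotProduct_mulVec, Finset.sum_mul]
    refine norm_sum_le_of_le _ fun i _ => ?_
    rw [norm_mul, mul_comm]
    exact mul_le_mul_of_nonneg_left (norm_le_pi_norm _ i) (norm_nonneg _)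
  have : 0 ≤ ∑ i, ‖u i‖ := Finset.sum_nonneg fun _ _ => norm_nonneg _
  have hD0 : 0 ≤ D := (norm_nonneg _).trans ((hD 0 le_rfl).trans (by simp))
  refine ⟨(∑ i, ‖u i‖ + K) * D + 1, by positivity, fun z hz => ?_⟩
  have hmax : max ‖M.r z‖ (N (M.q z)) ≤ (∑ i, ‖u i‖ + K) * ‖M.q z‖ := by
    rw [add_mul]
    exact max_le ((hr z hz).trans (le_add_of_nonneg_right (by positivity)))
      ((hK _).trans (le_add_of_nonneg_left (by positivity)))
  have hzq : ‖z‖ * ‖M.q z‖ ≤ D := by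
    have h := (le_div_iff₀ (by positivity)).1 (hD z hz)
    linarith [norm_nonneg (M.q z)]
  calc ‖z‖ * max ‖M.r z‖ (N (M.q z)) ≤ ‖z‖ * ((∑ i, ‖u i‖ + K) * ‖M.q z‖) := by gcongr
    _ = (∑ i, ‖u i‖ + K) * (‖z‖ * ‖M.q z‖) := by ring
    _ ≤ (∑ i, ‖u i‖ + K) * D + 1 :=
      (mul_le_mul_of_nonneg_left hzq (by positivity)).trans (le_add_of_nonneg_right zero_le_one)

/-- The last rows `c n` of the convolution quadrature weights with transfer function `f` and step
size `h`, expressed through interpolants of `f` on the spectrum of `Δ(ζ) / h`. -/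
def HasQuadratureWeights (M : RungeKutta m) (h : ℝ) (f : ℂ → ℂ) (c : ℕ → Fin (m + 1) → ℂ) : Prop :=
  ∀ ζ : ℂ, ‖ζ‖ < 1 → ∃ P : ℂ[X], InterpolatesOnSpectrum f ((h : ℂ)⁻¹ • M.symbol ζ) P ∧
    HasSum (fun n => ζ ^ n • c n) (aeval ((h : ℂ)⁻¹ • M.symbol ζ) P (Fin.last m))

namespace HasQuadratureWeights

variable {h : ℝ} {f g : ℂ → ℂ} {c d : ℕ → Fin (m + 1) → ℂ}

theorem add (hf : M.HasQuadratureWeights h f c) (hg : M.HasQuadratureWeights h g d) :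
    M.HasQuadratureWeights h (fun z => f z + g z) (fun n => c n + d n) := by
  intro ζ hζ
  obtain ⟨P, hP, hc⟩ := hf ζ hζ
  obtain ⟨Q, hQ, hd⟩ := hg ζ hζ
  refine ⟨P + Q, hP.add hQ, ?_⟩
  rw [map_add]
  exact (hc.add hd).congr_fun fun n => smul_add _ _ _

theorem congr (hf : M.HasQuadratureWeights h f c) (hM : M.StifflyAStable) (hh : 0 < h)
    (hfg : ∀ z, 0 < z.re → f z = g z) : M.HasQuadratureWeights h g c := by
  intro ζ hζ
  obtain ⟨P, hP, hc⟩ := hf ζ hζ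
  refine ⟨P, hP.congr fun μ hμ => ?_, hc⟩
  filter_upwards [(isOpen_lt continuous_const continuous_re).mem_nhds
    (hM.re_pos_of_isRoot_charpoly hh hζ hμ)] with z hz
  exact hfg z hz

theorem powerCoeff_matrixFunction (hf : M.HasQuadratureWeights h f c) (n : ℕ) :
    powerCoeff (fun ζ => matrixFunction f ((h : ℂ)⁻¹ • M.symbol ζ)) n (Fin.last m) = c n := by
  ext j
  refine iteratedDeriv_div_factorial_of_hasSum (c := fun n => c n j) (fun ζ hζ => ?_) n
  obtain ⟨P, hP, hc⟩ := hf ζ hζ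
  simp only [hP.matrixFunction_eq]
  exact Pi.hasSum.1 hc j

end HasQuadratureWeights

namespace StifflyAStable

theorem exists_norm_eVec_le (hM : M.StifflyAStable) {h : ℝ} (hh : 0 < h) :
    ∃ D : ℝ, ∀ n, ∀ z : ℂ, z.re ≤ 0 → ‖M.eVec n (h * z)‖ ≤ D / (1 + ‖z‖) := by
  obtain ⟨D, hD⟩ := hM.exists_norm_q_le
  have hD0 : 0 ≤ D := (norm_nonneg _).trans ((hD 0 le_rfl).trans (by simp))
  refine ⟨D * (1 + 1 / h), fun n z hz => ?_⟩
  have hhz := re_ofReal_mul_nonpos hh hz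
  rw [hM.eVec_eq n hhz, norm_smul, norm_pow]
  calc ‖M.r (h * z)‖ ^ n * ‖M.q (h * z)‖ ≤ D / (1 + ‖(h : ℂ) * z‖) :=
        (mul_le_of_le_one_left (norm_nonneg _)
          (pow_le_one₀ (norm_nonneg _) (hM.norm_r_le _ hhz))).trans (hD _ hhz)
    _ ≤ D * (1 + 1 / h) / (1 + ‖z‖) := by
        rw [norm_mul, norm_real, Real.norm_of_nonneg hh.le,
          div_le_div_iff₀ (by positivity) (by positivity), mul_assoc]
        refine mul_le_mul_of_nonneg_left ?_ hD0
        have : (1 + 1 / h) * (1 + h * ‖z‖) = 1 + ‖z‖ + (h * ‖z‖ + 1 / h) := by field_simp; ring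
        rw [this]
        exact le_add_of_nonneg_right (by positivity)

variable {α : Type*} [MeasurableSpace α] {μ : Measure α} {w φ : α → ℂ} {h : ℝ}

theorem aestronglyMeasurable_eVec (hM : M.StifflyAStable) (H : CauchyDatum μ w φ) (hh : 0 < h)
    (n : ℕ) : AEStronglyMeasurable (fun a => M.eVec n (h * w a)) μ := by
  have hmeas : Measurable fun z : ℂ => M.r (h * z) ^ n • M.q (h * z) :=
    ((M.measurable_r.comp (measurable_const_mul _)).pow_const n).smul
      (M.measurable_q.comp (measurable_const_mul _))
  refine (hmeas.comp_aemeasurable H.measurable_curve.aemeasurable).aestronglyMeasurable.congr ?_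
  filter_upwards [H.re_nonpos] with a ha
  exact (hM.eVec_eq n (re_ofReal_mul_nonpos hh ha)).symm

theorem integrable_smul_eVec (hM : M.StifflyAStable) (H : CauchyDatum μ w φ) (hh : 0 < h) (n : ℕ) :
    Integrable (fun a => φ a • M.eVec n (h * w a)) μ := by
  obtain ⟨D, hD⟩ := hM.exists_norm_eVec_le hh
  exact H.integrable_smul (hM.aestronglyMeasurable_eVec H hh n) fun a ha => hD n _ ha

theorem hasSum_integral_resolvent (hM : M.StifflyAStable) (H : CauchyDatum μ w φ) (hh : 0 < h)
    {ζ : ℂ} (hζ : ‖ζ‖ < 1) :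
    HasSum (fun n => ζ ^ n • -(h : ℂ) • ∫ a, φ a • M.eVec n (h * w a) ∂μ)
      (∫ a, φ a • (w a • 1 - (h : ℂ)⁻¹ • M.symbol ζ)⁻¹ (Fin.last m) ∂μ) := by
  obtain ⟨D, hD⟩ := hM.exists_norm_eVec_le hh
  have hint : ∀ n, Integrable (fun a => ζ ^ n • -(h : ℂ) • φ a • M.eVec n (h * w a)) μ :=
    fun n => ((hM.integrable_smul_eVec H hh n).fun_smul (-(h : ℂ))).fun_smul (ζ ^ n)
  have hbound : ∀ n, ∫ a, ‖ζ ^ n • -(h : ℂ) • φ a • M.eVec n (h * w a)‖ ∂μ ≤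
      ‖ζ‖ ^ n * (h * D * ∫ a, ‖φ a‖ / (1 + ‖w a‖) ∂μ) := fun n => by
    rw [← integral_const_mul, ← integral_const_mul]
    refine integral_mono_ae (hint n).norm ((H.integrable.const_mul _).const_mul _) ?_
    filter_upwards [H.re_nonpos] with a ha
    simp only [norm_smul, norm_pow, norm_neg, norm_real, Real.norm_of_nonneg hh.le]
    calc ‖ζ‖ ^ n * (h * (‖φ a‖ * ‖M.eVec n (h * w a)‖)) ≤
          ‖ζ‖ ^ n * (h * (‖φ a‖ * (D / (1 + ‖w a‖)))) := by gcongr; exact hD n _ ha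
      _ = ‖ζ‖ ^ n * (h * D * (‖φ a‖ / (1 + ‖w a‖))) := by ring
  have hsum := hasSum_integral_of_summable_integral_norm hint
    (Summable.of_nonneg_of_le (fun n => integral_nonneg fun a => norm_nonneg _) hbound
      ((summable_geometric_of_lt_one (norm_nonneg ζ) hζ).mul_right _))
  simp only [integral_smul] at hsum
  refine (congrArg (HasSum _) (integral_congr_ae ?_)).mp hsum
  filter_upwards [H.re_nonpos] with a ha
  have hz := re_ofReal_mul_nonpos hh ha
  have hres := ((hM.hasSum_eVec hz hζ).const_smul (-(h : ℂ))).const_smul (φ a)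
  rw [← hM.inv_smul_one_sub_smul_symbol_last hh ha hζ] at hres
  refine (hres.congr_fun fun n => ?_).tsum_eq
  rw [hM.eVec_eq n hz, smul_comm (-(h : ℂ)) (ζ ^ n), smul_comm (φ a) (ζ ^ n),
    smul_comm (φ a) (-(h : ℂ))]

theorem hasQuadratureWeights_integral (hM : M.StifflyAStable) (H : CauchyDatum μ w φ) (hh : 0 < h) :
    M.HasQuadratureWeights h (fun z => ∫ a, φ a / (w a - z) ∂μ)
      (fun n => -(h : ℂ) • ∫ a, φ a • M.eVec n (h * w a) ∂μ) := by
  intro ζ hζ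
  obtain ⟨P, hP, hlast⟩ :=
    H.exists_interpolatesOnSpectrum fun μ => hM.re_pos_of_isRoot_charpoly hh hζ (μ := μ)
  refine ⟨P, hP, ?_⟩
  rw [hlast]
  exact hM.hasSum_integral_resolvent H hh hζ

end StifflyAStable

variable {h ξ : ℝ}

theorem cut_density_smul (x : ℝ) (n : ℕ) (l : ℝ) :
    ((cutValue x 1 l - cutValue x (-1) l) / (2 * Real.pi * I)) • M.eVec n (h * -(l : ℂ)) =
      (-(2 * (Real.pi : ℂ) * I)⁻¹) • jumpFn x l • M.eVec n (-((h : ℂ) * l)) := by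
  rw [jumpFn_eq, smul_smul, mul_neg, ← neg_sub, div_eq_inv_mul, mul_neg, neg_mul]

theorem line_density_smul (x : ℝ) (n : ℕ) (y : ℝ) :
    (-transferFn x (verticalLine ξ y) / (2 * Real.pi)) • M.eVec n (h * verticalLine ξ y) =
      (-(2 * (Real.pi : ℂ))⁻¹) •
        transferFn x (verticalLine ξ y) • M.eVec n (h * verticalLine ξ y) := by
  rw [smul_smul, div_eq_inv_mul, mul_neg, neg_mul]

namespace StifflyAStable

theorem integrableOn_jumpFn_smul_eVec (hM : M.StifflyAStable) (hh : 0 < h) (hξ : 0 ≤ ξ) (x : ℝ)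
    (n : ℕ) : IntegrableOn (fun l : ℝ => jumpFn x l • M.eVec n (-((h : ℂ) * l))) (Ioc 0 ξ) := by
  have key := hM.integrable_smul_eVec ((cutFunction_transferFn x hξ).cauchyDatum_cut hξ) hh n
  simp only [cut_density_smul] at key
  exact (integrable_fun_smul_iff (by simp) _).1 key

theorem integrable_transferFn_smul_eVec (hM : M.StifflyAStable) (hh : 0 < h) (hξ : 0 ≤ ξ) (x : ℝ)
    (n : ℕ) :
    Integrable fun y => transferFn x (verticalLine ξ y) • M.eVec n (h * verticalLine ξ y) := by
  have key := hM.integrable_smul_eVec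
    ((cutFunction_transferFn x hξ).cauchyDatum_verticalLine hξ) hh n
  simp only [line_density_smul] at key
  exact (integrable_fun_smul_iff (by simp) _).1 key

theorem weight_sub_truncated (hM : M.StifflyAStable) (hh : 0 < h) (hξ : 0 < ξ) (x : ℝ) (n : ℕ) :
    M.weight h x n - M.truncated h ξ x n = ((h : ℂ) / (2 * Real.pi)) •
      ∫ y, transferFn x (verticalLine ξ y) • M.eVec n (h * verticalLine ξ y) := by
  have hcut := cutFunction_transferFn x hξ.le
  have hw := (((hM.hasQuadratureWeights_integral (hcut.cauchyDatum_cut hξ.le) hh).add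
    (hM.hasQuadratureWeights_integral (hcut.cauchyDatum_verticalLine hξ.le) hh)).congr hM hh
      fun z hz => (hcut.eq_integral_cut_add_integral_line hξ hz).symm).powerCoeff_matrixFunction n
  rw [weight, hw, truncated, intervalIntegral.integral_of_le hξ.le]
  simp only [cut_density_smul, line_density_smul, integral_smul]
  simp only [smul_smul, neg_mul_neg, ← div_eq_mul_inv, add_sub_cancel_left]

end StifflyAStable

theorem lineIntegrand_eq (N : Seminorm ℂ (Fin (m + 1) → ℂ)) (x : ℝ) (n : ℕ) {s : ℝ}
    (hs : s = 1 ∨ s = -1) (y : ℝ) : M.lineIntegrand N h ξ x n s y =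
      2 * N (transferFn x (verticalLine ξ (s * y)) • M.eVec n (h * verticalLine ξ (s * y))) := by
  have hline : -(ξ : ℂ) + I * s * y = verticalLine ξ (s * y) := by
    rw [verticalLine, ofReal_mul, mul_assoc, mul_comm I]
  have hnorm : √‖verticalLine ξ (s * y)‖ = (ξ ^ 2 + y ^ 2) ^ (1 / 4 : ℝ) := by
    have hs2 : s ^ 2 = 1 := by rcases hs with rfl | rfl <;> norm_num
    rw [norm_verticalLine, mul_pow, hs2, one_mul, Real.sqrt_eq_rpow, Real.sqrt_eq_rpow,
      ← Real.rpow_mul (by positivity)]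
    norm_num
  rw [map_smul_eq_mul, norm_transferFn, hnorm, lineIntegrand, Real.rpow_neg (by positivity), hline]
  ring

namespace StifflyAStable

theorem integrableOn_lineIntegrand (hM : M.StifflyAStable) (N : Seminorm ℂ (Fin (m + 1) → ℂ))
    (hh : 0 < h) (hξ : 0 ≤ ξ) (x : ℝ) (n : ℕ) {s : ℝ} (hs : s = 1 ∨ s = -1) :
    IntegrableOn (M.lineIntegrand N h ξ x n s) (Ioi 0) := by
  have hint := (integrable_seminorm_comp (continuous_seminorm_of_finiteDimensional N)
    (hM.integrable_transferFn_smul_eVec hh hξ x n)).const_mul 2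
  rw [funext (lineIntegrand_eq N x n hs)]
  exact (hint.comp_mul_left' (by rcases hs with rfl | rfl <;> norm_num)).integrableOn

theorem seminorm_weight_sub_truncated_le (hM : M.StifflyAStable)
    (N : Seminorm ℂ (Fin (m + 1) → ℂ)) (hh : 0 < h) (hξ : 0 < ξ) (x : ℝ) (n : ℕ) :
    N (M.weight h x n - M.truncated h ξ x n) ≤
      h / (4 * Real.pi) * (∫ y in Ioi (0 : ℝ), M.lineIntegrand N h ξ x n 1 y) +
      h / (4 * Real.pi) * (∫ y in Ioi (0 : ℝ), M.lineIntegrand N h ξ x n (-1) y) := by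
  have hN := continuous_seminorm_of_finiteDimensional N
  have hv := hM.integrable_transferFn_smul_eVec hh hξ.le x n
  have hNv := integrable_seminorm_comp hN hv
  have hnorm : ‖(h : ℂ) / (2 * Real.pi)‖ = h / (2 * Real.pi) := by
    rw [norm_div, norm_mul, norm_real, norm_real, Real.norm_of_nonneg hh.le,
      Real.norm_of_nonneg Real.pi_pos.le, RCLike.norm_ofNat]
  simp only [funext (lineIntegrand_eq N x n (Or.inl rfl)),
    funext (lineIntegrand_eq N x n (Or.inr rfl)), one_mul, neg_one_mul, integral_const_mul]
  rw [hM.weight_sub_truncated hh hξ, map_smul_eq_mul, hnorm, integral_comp_neg_Ioi 0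
    fun y => N (transferFn x (verticalLine ξ y) • M.eVec n (h * verticalLine ξ y)), neg_zero]
  calc _ ≤ h / (2 * Real.pi) *
        ∫ y, N (transferFn x (verticalLine ξ y) • M.eVec n (h * verticalLine ξ y)) :=
        mul_le_mul_of_nonneg_left (seminorm_integral_le hN hv) (by positivity)
    _ = _ := by
        rw [← intervalIntegral.integral_Iic_add_Ioi hNv.integrableOn hNv.integrableOn (b := 0)]
        ring

end StifflyAStable

end RungeKutta

section Constants

theorem Gamma_three_quarters_le : Real.Gamma (3 / 4) ≤ 4 / 3 := by
  have hconv := Real.convexOn_Gamma.2 (show (1 : ℝ) ∈ Ioi 0 by norm_num)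
    (show (2 : ℝ) ∈ Ioi 0 by norm_num) (show (0 : ℝ) ≤ 1 / 4 by norm_num)
    (show (0 : ℝ) ≤ 3 / 4 by norm_num) (by norm_num)
  rw [Real.Gamma_one, Real.Gamma_two] at hconv
  have hrec := Real.Gamma_add_one (show (3 / 4 : ℝ) ≠ 0 by norm_num)
  norm_num at hconv hrec
  linarith

/- The exact value of `∫₀^∞ (ξ² + y²)^(-3/4) dy` would give the error bound with half the claimed
constant; this slack lets the elementary bound `3 / √ξ` for the integral replace it. -/
theorem three_div_two_pi_div_sqrt_le {ξ : ℝ} (hξ : 0 ≤ ξ) :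
    3 / (2 * Real.pi) / √ξ ≤ √(2 * Real.pi / ξ) / (2 * Real.Gamma (3 / 4) ^ 2) := by
  have hΓ0 : 0 < Real.Gamma (3 / 4) := Real.Gamma_pos_of_pos (by norm_num)
  have hΓ : Real.Gamma (3 / 4) ^ 2 ≤ (4 / 3) ^ 2 :=
    pow_le_pow_left₀ hΓ0.le Gamma_three_quarters_le 2
  have hπ : 5 / 2 ≤ √(2 * Real.pi) := Real.le_sqrt_of_sq_le (by linarith [Real.pi_gt_d2])
  have hone : 3 / (2 * Real.pi) ≤ √(2 * Real.pi) / (2 * Real.Gamma (3 / 4) ^ 2) := by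
    rw [div_le_div_iff₀ (by positivity) (by positivity)]
    nlinarith [Real.pi_gt_three]
  rw [Real.sqrt_div' _ hξ, div_right_comm (√(2 * Real.pi))]
  exact div_le_div_of_nonneg_right hone (Real.sqrt_nonneg ξ)

variable {ξ : ℝ}

theorem sq_add_sq_rpow_le {t y : ℝ} (ht : 0 < t) (h : t ^ 2 ≤ ξ ^ 2 + y ^ 2) :
    (ξ ^ 2 + y ^ 2) ^ (-(3 / 4) : ℝ) ≤ t ^ (-(3 / 2) : ℝ) := by
  rw [show (-(3 / 2) : ℝ) = (2 : ℕ) * (-(3 / 4)) by norm_num, Real.rpow_mul ht.le,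
    Real.rpow_natCast]
  exact Real.rpow_le_rpow_of_nonpos (by positivity) h (by norm_num)

theorem integrable_sq_add_sq_rpow (hξ : 0 < ξ) :
    Integrable fun y : ℝ => (ξ ^ 2 + y ^ 2) ^ (-(3 / 4) : ℝ) := by
  have hone : Integrable fun y : ℝ => (1 + ‖y‖ ^ 2) ^ (-(3 / 2) / 2 : ℝ) :=
    integrable_rpow_neg_one_add_norm_sq (by norm_num)
  refine ((hone.comp_div hξ.ne').const_mul ((ξ ^ 2) ^ (-(3 / 4) : ℝ))).congr
    (Eventually.of_forall fun y => ?_)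
  have hsq : ξ ^ 2 * (1 + ‖y / ξ‖ ^ 2) = ξ ^ 2 + y ^ 2 := by
    rw [Real.norm_eq_abs, sq_abs, div_pow, mul_add, mul_one, mul_div_cancel₀ _ (by positivity)]
  simp only
  rw [← hsq, Real.mul_rpow (by positivity) (by positivity)]
  norm_num

theorem integral_Ioc_sq_add_sq_rpow_le (hξ : 0 < ξ) :
    ∫ y in Ioc 0 ξ, (ξ ^ 2 + y ^ 2) ^ (-(3 / 4) : ℝ) ≤ 1 / √ξ :=
  calc ∫ y in Ioc 0 ξ, (ξ ^ 2 + y ^ 2) ^ (-(3 / 4) : ℝ) ≤ ∫ _ in Ioc 0 ξ, ξ ^ (-(3 / 2) : ℝ) :=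
        setIntegral_mono (integrable_sq_add_sq_rpow hξ).integrableOn (by simp) fun y =>
          sq_add_sq_rpow_le hξ (le_add_of_nonneg_right (sq_nonneg y))
    _ = ξ ^ (1 : ℝ) * ξ ^ (-(3 / 2) : ℝ) := by
        rw [setIntegral_const, Real.volume_real_Ioc_of_le hξ.le, sub_zero, smul_eq_mul,
          Real.rpow_one]
    _ = 1 / √ξ := by
        rw [← Real.rpow_add hξ, Real.sqrt_eq_rpow, one_div, ← Real.rpow_neg hξ.le]
        norm_num

theorem integral_Ioi_sq_add_sq_rpow_le (hξ : 0 < ξ) :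
    ∫ y in Ioi ξ, (ξ ^ 2 + y ^ 2) ^ (-(3 / 4) : ℝ) ≤ 2 / √ξ :=
  calc ∫ y in Ioi ξ, (ξ ^ 2 + y ^ 2) ^ (-(3 / 4) : ℝ) ≤ ∫ y in Ioi ξ, y ^ (-(3 / 2) : ℝ) :=
        setIntegral_mono_on (integrable_sq_add_sq_rpow hξ).integrableOn
          (integrableOn_Ioi_rpow_of_lt (by norm_num) hξ) measurableSet_Ioi fun y hy =>
          sq_add_sq_rpow_le (hξ.trans hy) (le_add_of_nonneg_left (sq_nonneg ξ))
    _ = 2 / √ξ := by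
        rw [integral_Ioi_rpow_of_lt (by norm_num) hξ, Real.sqrt_eq_rpow,
          show (-(3 / 2) + 1 : ℝ) = -(1 / 2) by norm_num, Real.rpow_neg hξ.le]
        ring

theorem integral_sq_add_sq_rpow_le (hξ : 0 < ξ) :
    ∫ y in Ioi (0 : ℝ), (ξ ^ 2 + y ^ 2) ^ (-(3 / 4) : ℝ) ≤ 3 / √ξ := by
  have hint := integrable_sq_add_sq_rpow hξ
  rw [← Ioc_union_Ioi_eq_Ioi hξ.le, setIntegral_union (Ioc_disjoint_Ioi le_rfl) measurableSet_Ioi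
    hint.integrableOn hint.integrableOn]
  calc _ ≤ 1 / √ξ + 2 / √ξ :=
        add_le_add (integral_Ioc_sq_add_sq_rpow_le hξ) (integral_Ioi_sq_add_sq_rpow_le hξ)
    _ = 3 / √ξ := by ring

end Constants

namespace RungeKutta

variable {m : ℕ} {M : RungeKutta m} {N : Seminorm ℂ (Fin (m + 1) → ℂ)} {h ξ C : ℝ}

theorem IsDecayConstant.seminorm_q_le (hC : M.IsDecayConstant N C) {z : ℂ} (hz : z.re ≤ 0)
    (hz0 : z ≠ 0) : N (M.q z) ≤ C / ‖z‖ :=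
  (le_div_iff₀' (norm_pos_iff.2 hz0)).2 ((mul_le_mul_of_nonneg_left (le_max_right _ _)
    (norm_nonneg z)).trans (hC.2 z hz))

namespace StifflyAStable

theorem norm_r_le_exp_gammaInf (hM : M.StifflyAStable) {η : ℝ} (hη : 0 < η) {z : ℂ}
    (hz : z.re = -η) : ‖M.r z‖ ≤ Real.exp (-(M.gammaInf η * η)) := by
  rcases eq_or_ne (M.r z) 0 with h0 | h0
  · rw [h0, norm_zero]
    exact (Real.exp_pos _).le
  have hbdd : BddBelow {t : ℝ | ∃ z : ℂ, -η ≤ z.re ∧ z.re < 0 ∧ M.r z ≠ 0 ∧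
      t = Real.log ‖M.r z‖ / z.re} := by
    refine ⟨0, ?_⟩
    rintro t ⟨w, -, hw, -, rfl⟩
    exact div_nonneg_of_nonpos (Real.log_nonpos (norm_nonneg _) (hM.norm_r_le w hw.le)) hw.le
  have hle : M.gammaInf η ≤ Real.log ‖M.r z‖ / z.re :=
    csInf_le hbdd ⟨z, hz.ge, by linarith, h0, rfl⟩
  rw [hz, div_neg, le_neg, div_le_iff₀ hη] at hle
  rw [← Real.log_le_iff_le_exp (norm_pos_iff.2 h0)]
  linarith

theorem seminorm_eVec_verticalLine_le (hM : M.StifflyAStable) (hC : M.IsDecayConstant N C)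
    (hh : 0 < h) (hξ : 0 < ξ) (n : ℕ) (y : ℝ) : N (M.eVec n (h * verticalLine ξ y)) ≤
      Real.exp (-(M.gammaInf (h * ξ) * (n * h) * ξ)) * (C / h / ‖verticalLine ξ y‖) := by
  have hre : ((h : ℂ) * verticalLine ξ y).re = -(h * ξ) := by
    rw [re_ofReal_mul, verticalLine_re, mul_neg]
  have hneg : ((h : ℂ) * verticalLine ξ y).re < 0 := hre.trans_lt (neg_neg_of_pos (mul_pos hh hξ))
  have hr : ‖M.r (h * verticalLine ξ y)‖ ^ n ≤
      Real.exp (-(M.gammaInf (h * ξ) * (n * h) * ξ)) :=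
    calc _ ≤ Real.exp (-(M.gammaInf (h * ξ) * (h * ξ))) ^ n :=
          pow_le_pow_left₀ (norm_nonneg _) (hM.norm_r_le_exp_gammaInf (mul_pos hh hξ) hre) n
      _ = _ := by rw [← Real.exp_nat_mul]; ring_nf
  have hq := hC.seminorm_q_le hneg.le fun h0 => hneg.ne (congrArg re h0)
  rw [norm_mul, norm_real, Real.norm_of_nonneg hh.le, ← div_div] at hq
  rw [hM.eVec_eq n hneg.le, map_smul_eq_mul, norm_pow]
  exact mul_le_mul hr hq (apply_nonneg N _) (Real.exp_pos _).le

theorem lineIntegrand_le (hM : M.StifflyAStable) (hC : M.IsDecayConstant N C) (hh : 0 < h)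
    (hξ : 0 < ξ) (x : ℝ) (n : ℕ) {s σ y : ℝ} (hs : s = 1 ∨ s = -1)
    (hσ : σ ≤ (Complex.exp (-(Real.pi * I) / 4) * verticalLine ξ (s * y) ^ (1 / 2 : ℂ)).re) :
    M.lineIntegrand N h ξ x n s y ≤
      C / h * Real.exp (-(M.gammaInf (h * ξ) * (n * h) * ξ)) * Real.exp (-|x| * σ) *
        (ξ ^ 2 + y ^ 2) ^ (-(3 / 4) : ℝ) := by
  have : 0 < C := hC.1
  have hpow : 1 / (√‖verticalLine ξ (s * y)‖ * ‖verticalLine ξ (s * y)‖) =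
      (ξ ^ 2 + y ^ 2) ^ (-(3 / 4) : ℝ) := by
    have hpos : 0 < ξ ^ 2 + y ^ 2 := by positivity
    have hs2 : s ^ 2 = 1 := by rcases hs with rfl | rfl <;> norm_num
    rw [norm_verticalLine, mul_pow, hs2, one_mul, Real.rpow_neg hpos.le, one_div,
      Real.sqrt_eq_rpow, Real.sqrt_eq_rpow, ← Real.rpow_mul hpos.le, ← Real.rpow_add hpos]
    norm_num
  have hexp : Real.exp (-|x| * (Complex.exp (-(Real.pi * I) / 4) *
      verticalLine ξ (s * y) ^ (1 / 2 : ℂ)).re) ≤ Real.exp (-|x| * σ) :=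
    Real.exp_le_exp.2 (mul_le_mul_of_nonpos_left hσ (neg_nonpos.2 (abs_nonneg x)))
  rw [lineIntegrand_eq N x n hs, map_smul_eq_mul, norm_transferFn, ← hpow]
  calc _ ≤ 2 * (Real.exp (-|x| * σ) / (2 * √‖verticalLine ξ (s * y)‖) *
        (Real.exp (-(M.gammaInf (h * ξ) * (n * h) * ξ)) *
          (C / h / ‖verticalLine ξ (s * y)‖))) := by
        gcongr
        exact hM.seminorm_eVec_verticalLine_le hC hh hξ n _
    _ = _ := by ring

theorem integral_lineIntegrand_le (hM : M.StifflyAStable) (hC : M.IsDecayConstant N C) (hh : 0 < h)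
    (hξ : 0 < ξ) (x : ℝ) (n : ℕ) {s σ : ℝ} (hs : s = 1 ∨ s = -1) (hσ : ∀ y : ℝ, 0 < y →
      σ ≤ (Complex.exp (-(Real.pi * I) / 4) * verticalLine ξ (s * y) ^ (1 / 2 : ℂ)).re) :
    ∫ y in Ioi (0 : ℝ), M.lineIntegrand N h ξ x n s y ≤
      C / h * Real.exp (-(M.gammaInf (h * ξ) * (n * h) * ξ)) * Real.exp (-|x| * σ) *
        (3 / √ξ) := by
  have : 0 < C := hC.1
  refine (setIntegral_mono_on (hM.integrableOn_lineIntegrand N hh hξ.le x n hs)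
    ((integrable_sq_add_sq_rpow hξ).integrableOn.const_mul _) measurableSet_Ioi
    fun y hy => hM.lineIntegrand_le hC hh hξ x n hs (hσ y hy)).trans ?_
  rw [integral_const_mul]
  exact mul_le_mul_of_nonneg_left (integral_sq_add_sq_rpow_le hξ) (by positivity)

theorem seminorm_weight_sub_truncated_le_exp (hM : M.StifflyAStable) (hC : M.IsDecayConstant N C)
    (hh : 0 < h) (hξ : 0 < ξ) (x : ℝ) (n : ℕ) :
    N (M.weight h x n - M.truncated h ξ x n) ≤
      C * (√(2 * Real.pi / ξ) / (2 * Real.Gamma (3 / 4) ^ 2)) * Real.cosh (|x| * √(ξ / 2)) *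
        Real.exp (-(M.gammaInf (h * ξ) * (n * h) * ξ)) := by
  have hC0 : 0 < C := hC.1
  have hupper := hM.integral_lineIntegrand_le hC hh hξ x n (s := 1) (σ := √(ξ / 2)) (Or.inl rfl)
    fun y hy => sqrt_le_re_sqrt (verticalLine_re ξ _) (by rw [verticalLine_im]; linarith)
  have hlower := hM.integral_lineIntegrand_le hC hh hξ x n (s := -1) (σ := -√(ξ / 2)) (Or.inr rfl)
    fun _ _ => neg_sqrt_le_re_sqrt hξ.le (verticalLine_re ξ _).ge
  set E := Real.exp (-(M.gammaInf (h * ξ) * (n * h) * ξ))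
  have hE0 : 0 < E := Real.exp_pos _
  have : 0 < Real.cosh (|x| * √(ξ / 2)) := Real.cosh_pos _
  calc _ ≤ h / (4 * Real.pi) * (C / h * E * Real.exp (-|x| * √(ξ / 2)) * (3 / √ξ)) +
        h / (4 * Real.pi) * (C / h * E * Real.exp (-|x| * -√(ξ / 2)) * (3 / √ξ)) :=
        (hM.seminorm_weight_sub_truncated_le N hh hξ x n).trans (by gcongr)
    _ = C * (3 / (2 * Real.pi) / √ξ) * Real.cosh (|x| * √(ξ / 2)) * E := by
        rw [Real.cosh_eq, neg_mul_neg, neg_mul]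
        field_simp
        ring
    _ ≤ _ := by
        have hconst := three_div_two_pi_div_sqrt_le hξ.le
        gcongr ?_ * _ * _
        exact mul_le_mul_of_nonneg_left hconst hC0.le

end StifflyAStable

end RungeKutta

theorem proposition4p1_general {m : ℕ} (M : RungeKutta m) (hM : M.StifflyAStable)
    (N : Seminorm ℂ (Fin (m + 1) → ℂ)) :
    (∃ C : ℝ, M.IsDecayConstant N C) ∧
    ∀ (h ξ x : ℝ) (n : ℕ), 0 < h → 0 < ξ →
      IntervalIntegrable (fun l : ℝ => jumpFn x l • M.eVec n (-((h : ℂ) * (l : ℂ)))) volume 0 ξ ∧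
      IntegrableOn (M.lineIntegrand N h ξ x n 1) (Ioi 0) ∧
      IntegrableOn (M.lineIntegrand N h ξ x n (-1)) (Ioi 0) ∧
      N (M.weight h x n - M.truncated h ξ x n) ≤
        h / (4 * Real.pi) * (∫ y in Ioi (0 : ℝ), M.lineIntegrand N h ξ x n 1 y) +
        h / (4 * Real.pi) * (∫ y in Ioi (0 : ℝ), M.lineIntegrand N h ξ x n (-1) y) ∧
      ∀ C : ℝ, M.IsDecayConstant N C →
        N (M.weight h x n - M.truncated h ξ x n) ≤
          C * (Real.sqrt (2 * Real.pi / ξ) / (2 * Real.Gamma (3 / 4) ^ 2)) *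
            Real.cosh (|x| * Real.sqrt (ξ / 2)) *
            Real.exp (-(M.gammaInf (h * ξ) * ((n : ℝ) * h) * ξ)) :=
  ⟨hM.exists_isDecayConstant N, fun _ _ x n hh hξ =>
    ⟨(intervalIntegrable_iff_integrableOn_Ioc_of_le hξ.le).2
      (hM.integrableOn_jumpFn_smul_eVec hh hξ.le x n),
    hM.integrableOn_lineIntegrand N hh hξ.le x n (Or.inl rfl),
    hM.integrableOn_lineIntegrand N hh hξ.le x n (Or.inr rfl),
    hM.seminorm_weight_sub_truncated_le N hh hξ x n,
    fun _ hC => hM.seminorm_weight_sub_truncated_le_exp hC hh hξ x n⟩⟩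

end

theorem proposition4p1 {m : ℕ} (M : RungeKutta m) (hM : M.Admissible)
    (N : Seminorm ℂ (Fin (m + 1) → ℂ)) (hN : ∀ v, N v = 0 → v = 0) :
    (∃ C : ℝ, M.IsDecayConstant N C) ∧
    ∀ (h ξ x : ℝ) (n : ℕ), 0 < h → 0 < ξ →
      IntervalIntegrable (fun l : ℝ => jumpFn x l • M.eVec n (-((h : ℂ) * (l : ℂ)))) volume 0 ξ ∧
      IntegrableOn (M.lineIntegrand N h ξ x n 1) (Ioi 0) ∧
      IntegrableOn (M.lineIntegrand N h ξ x n (-1)) (Ioi 0) ∧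
      N (M.weight h x n - M.truncated h ξ x n) ≤
        h / (4 * Real.pi) * (∫ y in Ioi (0 : ℝ), M.lineIntegrand N h ξ x n 1 y) +
        h / (4 * Real.pi) * (∫ y in Ioi (0 : ℝ), M.lineIntegrand N h ξ x n (-1) y) ∧
      ∀ C : ℝ, M.IsDecayConstant N C →
        N (M.weight h x n - M.truncated h ξ x n) ≤
          C * (Real.sqrt (2 * Real.pi / ξ) / (2 * Real.Gamma (3 / 4) ^ 2)) *
            Real.cosh (|x| * Real.sqrt (ξ / 2)) *
            Real.exp (-(M.gammaInf (h * ξ) * ((n : ℝ) * h) * ξ)) :=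
  proposition4p1_general M hM.stifflyAStable N
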